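/- Let $M\ge 2$ and $N\ge 0$ be integers, and let $D=\{\alpha_1,\dots,\alpha_M\}\cup\{1_1,\dots,1_N\}\cup\{\beta_1,\dots,\beta_M\}$ be a discrete alphabet of $2M+N$ symbols. Consider the monoid with zero (zero $0$, unit $1$) generated by $D$ subject to the relations $\alpha_i\cdot\beta_j=\delta_{i,j}$ for $i,j\in\{1,\dots,M\}$, $1_k\cdot 1_\ell=1$ for $k,\ell\in\{1,\dots,N\}$, and $\omega\cdot 1_\ell=1_\ell\cdot\omega=\omega$ for every finite word $\omega$ in $D$ and every $\ell\in\{1,\dots,N\}$. For a finite word $\omega_1\cdots\omega_n$ in $D$ let $\mathrm{red}(\omega_1\cdots\omega_n)$ be the product of its letters in this monoid. The $(M,N)$ Dyck-Motzkin shift is $$\Sigma_D=\{x\in D^{\mathbb Z}\colon \mathrm{red}(x_j\cdots x_k)\neq 0\text{ for all } j,k\in\mathbb Z \text{ with } j<k\},$$ with the topology induced by the product topology on $D^{\mathbb Z}$ and with the left shift $(\sigma x)_i=x_{i+1}$. For $x\in\Sigma_D$ and $j\in\mathbb Z$ let $G_j(x)=1$ if $x_j\in\{\alpha_1,\dots,\alpha_M\}$,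 $G_j(x)=-1$ if $x_j\in\{\beta_1,\dots,\beta_M\}$, and $G_j(x)=0$ otherwise. Let $H_i(x)=\sum_{j=0}^{i-1}G_j(x)$ for $i\ge 1$, $H_0(x)=0$, and $H_i(x)=-\sum_{j=i}^{-1}G_j(x)$ for $i\le -1$. Put $$A_\alpha=\Big\{x\in\Sigma_D\colon \lim_{i\to\infty}H_i(x)=\infty,\ \lim_{i\to-\infty}H_i(x)=-\infty\Big\},$$ $$A_\beta=\Big\{x\in\Sigma_D\colon \lim_{i\to\infty}H_i(x)=-\infty,\ \lim_{i\to-\infty}H_i(x)=\infty\Big\}.$$ For $\gamma\in\{\alpha,\beta\}$ let $M^{\rm e}_\gamma(\Sigma_D)$ be the space of shift-invariant ergodic Borel probability measures $\mu$ on $\Sigma_D$ with $\mu(A_\gamma)=1$, endowed with the weak* topology. Then for each $\gamma\in\{\alpha,\beta\}$ the space $M^{\rm e}_\gamma(\Sigma_D)$ is path connected and locally path connected. -/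

import Mathlib

open MeasureTheory Filter

namespace DyckMotzkin

/-- The alphabet with `2 * M + N` symbols: left brackets, right brackets and units. -/
inductive Symbol (M N : ℕ) : Type
  | left (i : Fin M) : Symbol M N
  | right (i : Fin M) : Symbol M N
  | unit (l : Fin N) : Symbol M N
  deriving DecidableEq, Fintype

/-- The finite alphabet carries the discrete topology. -/
instance (M N : ℕ) : TopologicalSpace (Symbol M N) := ⊥

instance (M N : ℕ) : DiscreteTopology (Symbol M N) := ⟨rfl⟩

instance (M N : ℕ) : MeasurableSpace (Symbol M N) := ⊤

instance (M N : ℕ) : BorelSpace (Symbol M N) := ⟨borel_eq_top_of_discrete.symm⟩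

/-- A single symbol as an element of the free monoid with zero on the alphabet. -/
def letter {M N : ℕ} (a : Symbol M N) : WithZero (FreeMonoid (Symbol M N)) :=
  ((FreeMonoid.of a : FreeMonoid (Symbol M N)) : WithZero (FreeMonoid (Symbol M N)))

/-- The defining relations of the Dyck-Motzkin monoid (those satisfied by `0` and `1` hold in the
free monoid with zero already). -/
inductive Rel (M N : ℕ) :
    WithZero (FreeMonoid (Symbol M N)) → WithZero (FreeMonoid (Symbol M N)) → Prop
  | matching (i : Fin M) : Rel M N (letter (.left i) * letter (.right i)) 1
  | mismatch (i j : Fin M) (h : i ≠ j) : Rel M N (letter (.left i) * letter (.right j)) 0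
  | unit_unit (k l : Fin N) : Rel M N (letter (.unit k) * letter (.unit l)) 1
  | mul_unit (w : FreeMonoid (Symbol M N)) (l : Fin N) : Rel M N ((w : WithZero _) * letter (.unit l)) w
  | unit_mul (w : FreeMonoid (Symbol M N)) (l : Fin N) : Rel M N (letter (.unit l) * (w : WithZero _)) w

/-- The monoid with zero generated by the alphabet subject to the relations `Rel`. -/
abbrev DMMonoid (M N : ℕ) : Type := (conGen (Rel M N)).Quotient

/-- The zero element of the Dyck-Motzkin monoid. -/
def zeroElt (M N : ℕ) : DMMonoid M N := (conGen (Rel M N)).mk' 0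

/-- `red` of a word: the product of its letters in the Dyck-Motzkin monoid. -/
def red {M N : ℕ} (w : List (Symbol M N)) : DMMonoid M N :=
  (w.map fun a => (conGen (Rel M N)).mk' (letter a)).prod

/-- The word `x_j x_{j+1} ⋯ x_k` (for `j ≤ k`) read off a bi-infinite sequence. -/
def subword {M N : ℕ} (x : ℤ → Symbol M N) (j k : ℤ) : List (Symbol M N) :=
  (List.range (k - j + 1).toNat).map fun n : ℕ => x (j + (n : ℤ))

/-- The `(M, N)` Dyck-Motzkin shift, a subset of the product space `D ^ ℤ`. -/
def shiftSpace (M N : ℕ) : Set (ℤ → Symbol M N) :=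
  {x | ∀ j k : ℤ, j < k → red (subword x j k) ≠ zeroElt M N}

/-- The left shift on the Dyck-Motzkin shift, `(σ x)_i = x_{i+1}`. -/
def shift (M N : ℕ) (x : shiftSpace M N) : shiftSpace M N :=
  ⟨fun i => x.1 (i + 1), by
    intro j k hjk
    have h := x.2 (j + 1) (k + 1) (by omega)
    have e : subword (fun i => x.1 (i + 1)) j k = subword x.1 (j + 1) (k + 1) := by
      unfold subword
      rw [show k + 1 - (j + 1) + 1 = k - j + 1 by ring]
      refine List.map_congr_left fun n _ => ?_
      beta_reduce
      rw [show j + (n : ℤ) + 1 = j + 1 + n by ring]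
    rw [e]
    exact h⟩

/-- Weight of a symbol: `1` for left brackets, `-1` for right brackets, `0` for units. -/
def weight {M N : ℕ} : Symbol M N → ℤ
  | .left _ => 1
  | .right _ => -1
  | .unit _ => 0

/-- The height `H_i(x)`: it is `∑_{0 ≤ j < i} G_j(x)` for `i ≥ 1`, `-∑_{i ≤ j < 0} G_j(x)` for
`i ≤ -1` and `0` for `i = 0` (empty sums vanish), where `G_j(x)` is the weight of `x_j`. -/
noncomputable def height {M N : ℕ} (i : ℤ) (x : shiftSpace M N) : ℤ :=
  ∑ j ∈ Finset.Ico 0 i, weight (x.1 j) - ∑ j ∈ Finset.Ico i 0, weight (x.1 j)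

/-- The set `A_α`. -/
def setAlpha (M N : ℕ) : Set (shiftSpace M N) :=
  {x | Tendsto (fun i : ℤ => height i x) atTop atTop ∧
    Tendsto (fun i : ℤ => height i x) atBot atBot}

/-- The set `A_β`. -/
def setBeta (M N : ℕ) : Set (shiftSpace M N) :=
  {x | Tendsto (fun i : ℤ => height i x) atTop atBot ∧
    Tendsto (fun i : ℤ => height i x) atBot atTop}

/-- Shift-invariant ergodic Borel probability measures giving full mass to `A`; the topology is
that of weak convergence, inherited from `ProbabilityMeasure`. -/
def ergodicOn {M N : ℕ} (A : Set (shiftSpace M N)) : Set (ProbabilityMeasure (shiftSpace M N)) :=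
  {μ | Ergodic (shift M N) (μ : Measure (shiftSpace M N)) ∧
    (μ : Measure (shiftSpace M N)) A = 1}

end DyckMotzkin

/-! Write `g` for the weight, with its sign reversed in the case of β. The argument first leaves the
Dyck-Motzkin shift and works on the full shift over the same alphabet, where no matching constraint
is present.

There an ergodic measure gives full mass to the sequences with drift exactly when the mean of `g` is
positive (`mem_driftErgodic_iff`). This condition is affine in the measure and survives mixing, but
a proper mixture of two distinct ergodic measures is not ergodic. The segment from `μ` to `ν` is
therefore perturbed: at each time, independently and with small probability, the sequence is
abandoned and restarted from a fresh independent sample, drawn from `ν` with probability `t` and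
from `μ` otherwise. The resulting process is a factor of a Bernoulli shift, hence ergodic
(`ergodic_restartLaw`). Its one-letter marginal is exactly that of the mixture
(`integral_restartPath_eval`), so the drift stays positive. On a finite window it differs from the
mixture by an error of the order of the restart rate, uniformly in `μ` and `ν`
(`abs_integral_restart_sub_mixedIntegral_le`). A rate `c * t * (1 - t)` then gives a continuous path
with the right end points, and a small `c` keeps the whole path near `μ` once `ν` is near `μ`, which
is local path connectedness.

To return to the Dyck-Motzkin shift, `repair` gives each matched bracket of one direction the label
of its partner. A sequence lies in the shift exactly when matched brackets have equal labels, so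
`repair` is a retraction; it commutes with the shift and keeps all heights. At a sequence with drift
every bracket to be relabelled has a partner at finite distance, so `repair` is continuous there. By
the continuous mapping theorem the space of the theorem is a retract of the space of drifting
ergodic measures on the full shift, and both connectedness properties pass to retracts. -/

namespace DyckMotzkin

/-! ### Heights and matched brackets -/

section Height

variable {D : Type*}

/-- The height `H_i` of a bi-infinite sequence with respect to a weight function on the alphabet. -/
noncomputable def heightOf (g : D → ℤ) (y : ℤ → D) (i : ℤ) : ℤ :=
  ∑ j ∈ Finset.Ico 0 i, g (y j) - ∑ j ∈ Finset.Ico i 0, g (y j)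

@[simp] lemma heightOf_zero (g : D → ℤ) (y : ℤ → D) : heightOf g y 0 = 0 := by
  simp [heightOf]

lemma heightOf_succ (g : D → ℤ) (y : ℤ → D) (i : ℤ) :
    heightOf g y (i + 1) = heightOf g y i + g (y i) := by
  unfold heightOf
  rcases le_or_gt 0 i with h | h
  · rw [Finset.Ico_eq_empty_of_le h, Finset.Ico_eq_empty_of_le (by omega : (0 : ℤ) ≤ i + 1),
      ← Finset.insert_Ico_right_eq_Ico_add_one h, Finset.sum_insert (by simp)]
    simp [add_comm]
  · rw [Finset.Ico_eq_empty_of_le h.le, Finset.Ico_eq_empty_of_le (by omega : i + 1 ≤ (0 : ℤ)),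
      ← Finset.insert_Ico_add_one_left_eq_Ico h, Finset.sum_insert (by simp)]
    simp

/-- Height increments see only the weights in between. This makes matching a local,
translation-invariant notion, whence the equivariance and continuity of relabelling. -/
lemma heightOf_sub_congr {g : D → ℤ} {D' : Type*} {g' : D' → ℤ} {y : ℤ → D} {z : ℤ → D'}
    {i j : ℤ} (c : ℤ) (hij : i ≤ j) (h : ∀ k, i ≤ k → k < j → g (y k) = g' (z (k + c))) :
    heightOf g y j - heightOf g y i = heightOf g' z (j + c) - heightOf g' z (i + c) := by
  induction j, hij using Int.leInduction with
  | base => simp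
  | succ n hn ih =>
    have h1 := ih fun k hk hk' => h k hk (by omega)
    have h2 := h n hn (by omega)
    rw [heightOf_succ, show n + 1 + c = n + c + 1 by ring, heightOf_succ]
    omega

lemma heightOf_neg (g : D → ℤ) (y : ℤ → D) (i : ℤ) :
    heightOf (fun a => -g a) y i = -heightOf g y i := by
  simp [heightOf]; ring

lemma heightOf_congr {g : D → ℤ} {y z : ℤ → D} (h : ∀ k, g (y k) = g (z k)) :
    heightOf g y = heightOf g z := by
  funext i; simp [heightOf, h]

/-- Sequences whose height tends to `∞` in the future and to `-∞` in the past. -/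
def driftSet (g : D → ℤ) : Set (ℤ → D) :=
  {y | Tendsto (heightOf g y) atTop atTop ∧ Tendsto (heightOf g y) atBot atBot}

end Height

variable {M N : ℕ}

/-- The left shift on all bi-infinite sequences. -/
def fullShift {D : Type*} (y : ℤ → D) : ℤ → D := fun i => y (i + 1)

/-- Positions `i < j` carry a left and a right bracket matched with each other. -/
def Matched (x : ℤ → Symbol M N) (i j : ℤ) : Prop :=
  i < j ∧ heightOf weight x (j + 1) = heightOf weight x i ∧
    ∀ q, i < q → q ≤ j → heightOf weight x i < heightOf weight x q

lemma Matched.left {x : ℤ → Symbol M N} {i j : ℤ} (h : Matched x i j) : ∃ k, x i = .left k := by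
  have h1 := h.2.2 (i + 1) (by omega) (by have := h.1; omega)
  rw [heightOf_succ] at h1
  cases hx : x i with
  | left k => exact ⟨k, rfl⟩
  | right k => simp [hx, weight] at h1
  | unit k => simp [hx, weight] at h1

lemma Matched.right {x : ℤ → Symbol M N} {i j : ℤ} (h : Matched x i j) : ∃ k, x j = .right k := by
  have h1 := h.2.2 j h.1 le_rfl
  have h2 := h.2.1
  rw [heightOf_succ] at h2
  cases hx : x j with
  | left k => simp [hx, weight] at h2; omega
  | right k => exact ⟨k, rfl⟩
  | unit k => simp [hx, weight] at h2; omega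

lemma Matched.congr {x y : ℤ → Symbol M N} {i j : ℤ} (c : ℤ)
    (h : ∀ k, i ≤ k → k ≤ j → weight (x k) = weight (y (k + c))) (hx : Matched x i j) :
    Matched y (i + c) (j + c) := by
  obtain ⟨h1, h2, h3⟩ := hx
  refine ⟨by omega, ?_, fun q hq hq' => ?_⟩
  · have := heightOf_sub_congr (g := weight) (g' := weight) (y := x) (z := y) (i := i) (j := j + 1) c
      (by omega) fun k hk hk' => h k hk (by omega)
    rw [show j + c + 1 = j + 1 + c by ring]
    omega
  · have := heightOf_sub_congr (g := weight) (g' := weight) (y := x) (z := y) (i := i) (j := q - c) c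
      (by omega) fun k hk hk' => h k hk (by omega)
    have h4 := h3 (q - c) (by omega) (by omega)
    rw [sub_add_cancel] at this
    omega

lemma Matched.congr_iff {x y : ℤ → Symbol M N} {i j : ℤ}
    (h : ∀ k, i ≤ k → k ≤ j → weight (x k) = weight (y k)) : Matched x i j ↔ Matched y i j := by
  constructor <;> intro hx
  · simpa using hx.congr (y := y) 0 (by simpa using h)
  · simpa using hx.congr (y := x) 0 (by simpa using fun k h1 h2 => (h k h1 h2).symm)

lemma matched_fullShift_iff {x : ℤ → Symbol M N} {i j : ℤ} :
    Matched (fullShift x) i j ↔ Matched x (i + 1) (j + 1) := by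
  constructor <;> intro hx
  · exact hx.congr (y := x) 1 fun k _ _ => rfl
  · simpa using hx.congr (y := fullShift x) (-1) fun k _ _ => by simp [fullShift]

lemma Matched.left_unique {x : ℤ → Symbol M N} {i i' j : ℤ} (h : Matched x i j)
    (h' : Matched x i' j) : i = i' := by
  obtain ⟨h1, h2, h3⟩ := h
  obtain ⟨h1', h2', h3'⟩ := h'
  rcases lt_trichotomy i i' with h | h | h
  · have := h3 i' h (by omega); omega
  · exact h
  · have := h3' i h (by omega); omega

lemma Matched.right_unique {x : ℤ → Symbol M N} {i j j' : ℤ} (h : Matched x i j)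
    (h' : Matched x i j') : j = j' := by
  obtain ⟨h1, h2, h3⟩ := h
  obtain ⟨h1', h2', h3'⟩ := h'
  rcases lt_trichotomy j j' with h | h | h
  · have := h3' (j + 1) (by omega) (by omega); omega
  · exact h
  · have := h3 (j' + 1) (by omega) (by omega); omega

/-- The height moves by at most one, so its first return to the level at `i` or below hits that
level exactly. The height at `j` is taken before the letter at `j`, so the partner sits at `j - 1`.
-/
lemma exists_matched_right {x : ℤ → Symbol M N} {i : ℤ} {k : Fin M} (hx : x i = .left k)
    (h : ∃ j, i < j ∧ heightOf weight x j ≤ heightOf weight x i) : ∃ j, Matched x i j := by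
  obtain ⟨j, ⟨h1, h2⟩, h3⟩ := Int.exists_least_of_bdd
    (P := fun j => i < j ∧ heightOf weight x j ≤ heightOf weight x i) ⟨i, fun z hz => hz.1.le⟩ h
  have h4 : heightOf weight x (i + 1) = heightOf weight x i + 1 := by
    rw [heightOf_succ, hx]; rfl
  have h5 : j ≠ i + 1 := by rintro rfl; omega
  have h6 : heightOf weight x i < heightOf weight x (j - 1) := by
    by_contra hc
    have := h3 (j - 1) ⟨by omega, by omega⟩
    omega
  refine ⟨j - 1, by omega, ?_, fun q hq hq' => ?_⟩
  · have h7 := heightOf_succ weight x (j - 1)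
    rw [sub_add_cancel] at h7 ⊢
    cases hj : x (j - 1) <;> simp only [hj, weight] at h7 <;> omega
  · by_contra hc
    have := h3 q ⟨hq, by omega⟩
    omega

lemma exists_matched_left {x : ℤ → Symbol M N} {j : ℤ} {k : Fin M} (hx : x j = .right k)
    (h : ∃ i, i < j ∧ heightOf weight x i < heightOf weight x j) : ∃ i, Matched x i j := by
  obtain ⟨i, ⟨h1, h2⟩, h3⟩ := Int.exists_greatest_of_bdd
    (P := fun i => i < j ∧ heightOf weight x i < heightOf weight x j) ⟨j, fun z hz => hz.1.le⟩ h
  have h4 : heightOf weight x (j + 1) = heightOf weight x j - 1 := by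
    rw [heightOf_succ, hx]; rfl
  have h7 := heightOf_succ weight x i
  have h6 : heightOf weight x j ≤ heightOf weight x (i + 1) := by
    rcases eq_or_ne (i + 1) j with h | h
    · rw [h]
    · by_contra hc
      have := h3 (i + 1) ⟨by omega, by omega⟩
      omega
  have h8 : heightOf weight x i = heightOf weight x j - 1 := by
    cases hj : x i <;> simp only [hj, weight] at h7 <;> omega
  refine ⟨i, h1, by omega, fun q hq hq' => ?_⟩
  rcases hq'.eq_or_lt with rfl | hlt
  · omega
  · by_contra hc
    have := h3 q ⟨by omega, by omega⟩
    omega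

/-- Matched brackets carry the same label. -/
def WellMatched (x : ℤ → Symbol M N) : Prop :=
  ∀ i j k l, Matched x i j → x i = .left k → x j = .right l → k = l

/-! ### The shift space consists of the well-matched sequences -/

section Monoid

/-- The class of a symbol in the Dyck-Motzkin monoid. -/
def letterClass (a : Symbol M N) : DMMonoid M N := (conGen (Rel M N)).mk' (letter a)

lemma mk'_eq_of_rel {u v : WithZero (FreeMonoid (Symbol M N))} (h : Rel M N u v) :
    (conGen (Rel M N)).mk' u = (conGen (Rel M N)).mk' v :=
  (Con.eq _).2 (ConGen.Rel.of _ _ h)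

lemma left_mul_right_self (i : Fin M) :
    letterClass (N := N) (.left i) * letterClass (.right i) = 1 := by
  unfold letterClass
  rw [← map_mul, mk'_eq_of_rel (Rel.matching i), map_one]

lemma left_mul_right_of_ne {i j : Fin M} (h : i ≠ j) :
    letterClass (N := N) (.left i) * letterClass (.right j) = zeroElt M N := by
  unfold letterClass
  rw [← map_mul, mk'_eq_of_rel (Rel.mismatch i j h), zeroElt]

lemma letterClass_unit (l : Fin N) : letterClass (M := M) (.unit l) = 1 := by
  unfold letterClass
  have h := mk'_eq_of_rel (Rel.mul_unit (M := M) (N := N) 1 l)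
  rwa [WithZero.coe_one, one_mul, map_one] at h

lemma zeroElt_mul (u : DMMonoid M N) : zeroElt M N * u = zeroElt M N := by
  obtain ⟨v, rfl⟩ := Con.mk'_surjective u
  unfold zeroElt
  rw [← map_mul, zero_mul]

lemma mul_zeroElt (u : DMMonoid M N) : u * zeroElt M N = zeroElt M N := by
  obtain ⟨v, rfl⟩ := Con.mk'_surjective u
  unfold zeroElt
  rw [← map_mul, mul_zero]

/-- The word of length `n` read off a sequence from position `i` on. -/
def segment {D : Type*} (x : ℤ → D) (i : ℤ) (n : ℕ) : List D :=
  (List.range n).map fun m : ℕ => x (i + (m : ℤ))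

lemma segment_succ {D : Type*} (x : ℤ → D) (i : ℤ) (n : ℕ) :
    segment x i (n + 1) = segment x i n ++ [x (i + n)] := by
  simp [segment, List.range_succ]

lemma red_append_singleton (w : List (Symbol M N)) (a : Symbol M N) :
    red (w ++ [a]) = red w * letterClass a := by
  simp [red, letterClass]

/-- The product of the left brackets on a stack, the top of the stack coming last. -/
def stackClass (N : ℕ) : List (Fin M) → DMMonoid M N
  | [] => 1
  | c :: s => stackClass N s * letterClass (.left c)

/-- Inside a matched pair the height stays above its value at `i`, so the opening bracket is never
cancelled: unless the product vanishes, it is a stack of left brackets with `k` at the bottom, as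
deep as the height gained. -/
lemma red_segment_of_matched {x : ℤ → Symbol M N} {i j : ℤ} {k : Fin M} (h : Matched x i j)
    (hk : x i = .left k) (n : ℕ) (hn : i + n + 1 ≤ j) :
    red (segment x i (n + 1)) = zeroElt M N ∨
      ∃ s : List (Fin M), (s.length : ℤ) + 1 = heightOf weight x (i + n + 1) - heightOf weight x i ∧
        red (segment x i (n + 1)) = stackClass N (s ++ [k]) := by
  induction n with
  | zero =>
    right
    refine ⟨[], ?_, ?_⟩
    · simp [heightOf_succ, hk, weight]
    · simp [segment, hk, red, stackClass, letterClass]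
  | succ n ih =>
    rw [segment_succ, red_append_singleton]
    have e : i + ((n + 1 : ℕ) : ℤ) = i + n + 1 := by push_cast; ring
    rw [e] at hn ⊢
    rcases ih (by omega) with h0 | ⟨s, hs, hr⟩
    · left; rw [h0, zeroElt_mul]
    · rw [hr, heightOf_succ]
      have h3 := h.2.2 (i + n + 1 + 1) (by omega) (by omega)
      rw [heightOf_succ] at h3
      cases hx : x (i + n + 1) with
      | left c =>
        right
        exact ⟨c :: s, by simp [weight]; omega, rfl⟩
      | unit l =>
        right
        exact ⟨s, by simp [weight]; omega, by rw [letterClass_unit, mul_one]⟩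
      | right c =>
        cases s with
        | nil => simp [hx, weight] at h3 hs; omega
        | cons d s =>
          rw [List.cons_append, stackClass, mul_assoc]
          rcases eq_or_ne d c with rfl | hdc
          · right
            refine ⟨s, ?_, by rw [left_mul_right_self, mul_one]⟩
            simp [weight] at hs ⊢; omega
          · left
            rw [left_mul_right_of_ne hdc, mul_zeroElt]

/-- Just before the closing bracket the height gained is one, so only the opening bracket is left on
the stack and a wrong label produces zero. -/
lemma wellMatched_of_mem_shiftSpace {x : ℤ → Symbol M N} (hx : x ∈ shiftSpace M N) :
    WellMatched x := by
  intro i j k l h hk hl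
  by_contra hkl
  obtain ⟨n, rfl⟩ : ∃ n : ℕ, j = i + n + 1 := ⟨(j - i - 1).toNat, by have := h.1; omega⟩
  refine hx i _ h.1 ?_
  have e : subword x i (i + n + 1) = segment x i (n + 1) ++ [x (i + n + 1)] := by
    have h1 : (i + n + 1 - i + 1 : ℤ).toNat = n + 1 + 1 := by omega
    have h2 : i + ((n + 1 : ℕ) : ℤ) = i + n + 1 := by push_cast; ring
    rw [← h2, ← segment_succ, h2, subword, h1, segment]
  rw [e, red_append_singleton, hl]
  rcases red_segment_of_matched h hk n le_rfl with h0 | ⟨s, hs, hr⟩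
  · rw [h0, zeroElt_mul]
  · have h4 := h.2.1
    rw [heightOf_succ, hl] at h4
    have h5 : s = [] := by
      apply List.eq_nil_of_length_eq_zero
      simp [weight] at h4
      omega
    rw [hr, h5]
    simp only [List.nil_append, stackClass, one_mul]
    exact left_mul_right_of_ne hkl

/-- One step of a pushdown machine with an infinite stack. -/
def stackStep : Symbol M N → (ℕ → Fin M) → Option (ℕ → Fin M)
  | .left k, t => some fun d => if d = 0 then k else t (d - 1)
  | .right l, t => if t 0 = l then some fun d => t (d + 1) else none
  | .unit _, t => some t

/-- The run of the pushdown machine on a word. -/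
def stackRun : List (Symbol M N) → (ℕ → Fin M) → Option (ℕ → Fin M)
  | [], t => some t
  | a :: w, t => (stackStep a t).bind (stackRun w)

lemma stackRun_append (u v : List (Symbol M N)) (t : ℕ → Fin M) :
    stackRun (u ++ v) t = (stackRun u t).bind (stackRun v) := by
  induction u generalizing t with
  | nil => rfl
  | cons a u ih =>
    simp only [List.cons_append, stackRun, Option.bind_assoc]
    congr 1; funext t'; exact ih t'

/-- The action of the free monoid with zero on stacks. -/
def stackAct (u : WithZero (FreeMonoid (Symbol M N))) (t : ℕ → Fin M) : Option (ℕ → Fin M) :=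
  WithZero.recZeroCoe (motive := fun _ => Option (ℕ → Fin M)) none (fun w => stackRun w.toList t) u

@[simp] lemma stackAct_zero (t : ℕ → Fin M) :
    stackAct (0 : WithZero (FreeMonoid (Symbol M N))) t = none := rfl

@[simp] lemma stackAct_coe (w : FreeMonoid (Symbol M N)) (t : ℕ → Fin M) :
    stackAct (w : WithZero (FreeMonoid (Symbol M N))) t = stackRun w.toList t := rfl

lemma stackAct_mul (u v : WithZero (FreeMonoid (Symbol M N))) (t : ℕ → Fin M) :
    stackAct (u * v) t = (stackAct u t).bind (stackAct v) := by
  induction u using WithZero.recZeroCoe with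
  | zero => simp
  | coe u =>
    induction v using WithZero.recZeroCoe with
    | zero => cases h : stackRun u.toList t <;> simp [h]
    | coe v =>
      rw [← WithZero.coe_mul, stackAct_coe, stackAct_coe, FreeMonoid.toList_mul, stackRun_append]
      rfl

/-- Elements of the free monoid with zero acting in the same way on stacks. -/
def stackCon (M N : ℕ) : Con (WithZero (FreeMonoid (Symbol M N))) where
  r u v := ∀ t, stackAct u t = stackAct v t
  iseqv := ⟨fun _ _ => rfl, fun h t => (h t).symm, fun h h' t => (h t).trans (h' t)⟩
  mul' {a b c d} h h' t := by
    rw [stackAct_mul, stackAct_mul, h t]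
    congr 1; funext t'; exact h' t'

lemma stackAct_letter (a : Symbol M N) (t : ℕ → Fin M) : stackAct (letter a) t = stackStep a t := by
  simp [letter, stackRun, FreeMonoid.toList_of]

/-- Proving a product nonzero needs a model of the monoid. Partial maps on infinite stacks satisfy
the relations, with zero acting as the nowhere defined map; infinite depth lets unmatched right
brackets act. -/
lemma conGen_le_stackCon : conGen (Rel M N) ≤ stackCon M N := by
  rw [Con.conGen_le]
  intro u v h t
  cases h with
  | matching i =>
    rw [stackAct_mul, stackAct_letter, ← WithZero.coe_one, stackAct_coe]
    simp [stackStep, stackRun, stackAct_letter]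
  | mismatch i j h =>
    rw [stackAct_mul, stackAct_letter]
    simp [stackStep, stackAct_letter, h]
  | unit_unit k l =>
    rw [stackAct_mul, stackAct_letter, ← WithZero.coe_one, stackAct_coe]
    simp [stackStep, stackRun, stackAct_letter]
  | mul_unit w l =>
    rw [stackAct_mul]
    cases h : stackRun w.toList t <;> simp [h, stackAct_letter, stackStep]
  | unit_mul w l =>
    rw [stackAct_mul]
    simp [stackAct_letter, stackStep]

lemma red_eq_mk' (w : List (Symbol M N)) :
    red w = (conGen (Rel M N)).mk' ((FreeMonoid.ofList w : FreeMonoid (Symbol M N)) :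
      WithZero (FreeMonoid (Symbol M N))) := by
  induction w with
  | nil => simp [red]
  | cons a w ih =>
    rw [FreeMonoid.ofList_cons, WithZero.coe_mul, map_mul, ← ih]
    simp [red, letter]

lemma red_ne_zero_of_stackRun {w : List (Symbol M N)} {t : ℕ → Fin M} (h : stackRun w t ≠ none) :
    red w ≠ zeroElt M N := by
  intro h0
  rw [red_eq_mk', zeroElt] at h0
  exact h (conGen_le_stackCon ((Con.eq _).1 h0) t)

/-- A stack that agrees with the future right brackets that are not matched after position `i`. -/
def StackCompatible (x : ℤ → Symbol M N) (i : ℤ) (t : ℕ → Fin M) : Prop :=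
  ∀ (d : ℕ) (p : ℤ) (l : Fin M), i ≤ p → heightOf weight x (p + 1) = heightOf weight x i - d - 1 →
    (∀ q, i ≤ q → q ≤ p → heightOf weight x i - d ≤ heightOf weight x q) → x p = .right l → t d = l

/-- The height falls below a given level for the first time at only one position, so each depth of
the stack is constrained by at most one future bracket. -/
lemma exists_stackCompatible [Nonempty (Fin M)] (x : ℤ → Symbol M N) (i : ℤ) :
    ∃ t, StackCompatible x i t := by
  classical
  let P (d : ℕ) (l : Fin M) : Prop := ∃ p : ℤ, i ≤ p ∧
    heightOf weight x (p + 1) = heightOf weight x i - d - 1 ∧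
    (∀ q, i ≤ q → q ≤ p → heightOf weight x i - d ≤ heightOf weight x q) ∧ x p = .right l
  have huniq : ∀ d l l', P d l → P d l' → l = l' := by
    rintro d l l' ⟨p, h1, h2, h3, h4⟩ ⟨p', h1', h2', h3', h4'⟩
    rcases lt_trichotomy p p' with h | h | h
    · have := h3' (p + 1) (by omega) (by omega); omega
    · subst h; simpa [h4] using h4'
    · have := h3 (p' + 1) (by omega) (by omega); omega
  -- Depths that the future never reaches are unconstrained.
  refine ⟨fun d => if h : ∃ l, P d l then h.choose else Classical.arbitrary _, ?_⟩
  intro d p l h1 h2 h3 h4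
  have h : ∃ l, P d l := ⟨l, p, h1, h2, h3, h4⟩
  simp only [dif_pos h]
  exact huniq d _ _ h.choose_spec ⟨p, h1, h2, h3, h4⟩

lemma StackCompatible.step {x : ℤ → Symbol M N} (hx : WellMatched x) {i : ℤ} {t : ℕ → Fin M}
    (ht : StackCompatible x i t) :
    ∃ t', stackStep (x i) t = some t' ∧ StackCompatible x (i + 1) t' := by
  have hs := heightOf_succ weight x i
  cases hi : x i with
  | unit l =>
    simp only [hi, weight] at hs
    refine ⟨t, rfl, fun d p l' h1 h2 h3 h4 => ht d p l' (by omega) (by omega) ?_ h4⟩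
    intro q hq hq'
    rcases hq.eq_or_lt with rfl | hlt
    · omega
    · have := h3 q (by omega) hq'; omega
  | right l =>
    simp only [hi, weight] at hs
    have h0 : t 0 = l := ht 0 i l le_rfl (by simp; omega) (fun q hq hq' => by
      obtain rfl : q = i := by omega
      simp) hi
    refine ⟨fun d => t (d + 1), by simp [stackStep, h0],
      fun d p l' h1 h2 h3 h4 => ht (d + 1) p l' (by omega) (by push_cast; omega) ?_ h4⟩
    intro q hq hq'
    rcases hq.eq_or_lt with rfl | hlt
    · omega
    · have := h3 q (by omega) hq'; push_cast; omega
  | left k =>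
    simp only [hi, weight] at hs
    refine ⟨_, rfl, fun d p l' h1 h2 h3 h4 => ?_⟩
    rcases Nat.eq_zero_or_pos d with rfl | hd
    · simp only [if_true]
      -- Depth zero is popped by the partner of the bracket just pushed; this is the only use of
      -- well-matchedness.
      refine hx i p k l' ⟨by omega, by simp at h2; omega, fun q hq hq' => ?_⟩ hi h4
      have := h3 q (by omega) hq'
      simp at this; omega
    · simp only [if_neg hd.ne']
      refine ht (d - 1) p l' (by omega) (by omega) ?_ h4
      intro q hq hq'
      rcases hq.eq_or_lt with rfl | hlt
      · omega
      · have := h3 q (by omega) hq'; omega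

lemma mem_shiftSpace_of_wellMatched [Nonempty (Fin M)] {x : ℤ → Symbol M N} (hx : WellMatched x) :
    x ∈ shiftSpace M N := by
  intro j k hjk
  obtain ⟨t, ht⟩ := exists_stackCompatible x j
  have key : ∀ n : ℕ, ∃ t', stackRun (segment x j n) t = some t' ∧ StackCompatible x (j + n) t' := by
    intro n
    induction n with
    | zero => exact ⟨t, rfl, by simpa using ht⟩
    | succ n ih =>
      obtain ⟨t', h1, h2⟩ := ih
      obtain ⟨t'', h3, h4⟩ := h2.step hx
      refine ⟨t'', ?_, by push_cast; rwa [← add_assoc]⟩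
      rw [segment_succ, stackRun_append, h1]
      simp [stackRun, h3]
  obtain ⟨t', h1, -⟩ := key (k - j + 1).toNat
  refine red_ne_zero_of_stackRun (t := t) ?_
  rw [show subword x j k = segment x j (k - j + 1).toNat from rfl, h1]
  simp

end Monoid

/-! ### Relabelling retracts the full shift onto the Dyck-Motzkin shift -/

section Relabel

/-- Give the bracket `a` the label of the bracket `c` of opposite direction. -/
def relabel : Symbol M N → Symbol M N → Symbol M N
  | .left _, .right l => .left l
  | .right _, .left k => .right k
  | a, _ => a

lemma weight_relabel (a c : Symbol M N) : weight (relabel a c) = weight a := by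
  cases a <;> cases c <;> rfl

/-- Position `i` is matched with position `j`, where `j` carries a right bracket if `b` is true and
a left bracket if `b` is false. -/
def Partner (b : Bool) (y : ℤ → Symbol M N) (i j : ℤ) : Prop :=
  bif b then Matched y i j else Matched y j i

lemma Partner.unique {b : Bool} {y : ℤ → Symbol M N} {i i' j : ℤ} (h : Partner b y i j)
    (h' : Partner b y i' j) : i = i' := by
  cases b
  · exact Matched.right_unique h h'
  · exact Matched.left_unique h h'

lemma Partner.congr_iff {b : Bool} {x y : ℤ → Symbol M N} {i j : ℤ}
    (h : ∀ k ∈ Set.uIcc i j, weight (x k) = weight (y k)) : Partner b x i j ↔ Partner b y i j := by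
  cases b
  · exact Matched.congr_iff fun k h1 h2 => h k (Set.mem_uIcc.2 (Or.inr ⟨h1, h2⟩))
  · exact Matched.congr_iff fun k h1 h2 => h k (Set.mem_uIcc.2 (Or.inl ⟨h1, h2⟩))

lemma partner_fullShift_iff {b : Bool} {x : ℤ → Symbol M N} {i j : ℤ} :
    Partner b (fullShift x) i j ↔ Partner b x (i + 1) (j + 1) := by
  cases b <;> exact matched_fullShift_iff

open Classical in
/-- Relabel all right brackets (if `b` is true) or all left brackets (if `b` is false) by the labels
of the brackets matched with them. -/
noncomputable def repairSeq (b : Bool) (y : ℤ → Symbol M N) (j : ℤ) : Symbol M N :=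
  if h : ∃ i, Partner b y i j then relabel (y j) (y h.choose) else y j

lemma repairSeq_of_partner {b : Bool} {y : ℤ → Symbol M N} {i j : ℤ} (h : Partner b y i j) :
    repairSeq b y j = relabel (y j) (y i) := by
  have h' : ∃ i, Partner b y i j := ⟨i, h⟩
  rw [repairSeq, dif_pos h', h'.choose_spec.unique h]

lemma repairSeq_of_not_partner {b : Bool} {y : ℤ → Symbol M N} {j : ℤ}
    (h : ¬∃ i, Partner b y i j) : repairSeq b y j = y j := dif_neg h

lemma weight_repairSeq (b : Bool) (y : ℤ → Symbol M N) (j : ℤ) :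
    weight (repairSeq b y j) = weight (y j) := by
  by_cases h : ∃ i, Partner b y i j
  · obtain ⟨i, hi⟩ := h
    rw [repairSeq_of_partner hi, weight_relabel]
  · rw [repairSeq_of_not_partner h]

/-- Relabelling keeps the weights, hence the matched pairs, and changes brackets of one direction
only, so the partner being copied keeps its own label. -/
lemma wellMatched_repairSeq (b : Bool) (y : ℤ → Symbol M N) : WellMatched (repairSeq b y) := by
  intro i j k l h hk hl
  replace h : Matched y i j := (Matched.congr_iff fun q _ _ => weight_repairSeq b y q).1 h
  obtain ⟨k', hk'⟩ := h.left
  obtain ⟨l', hl'⟩ := h.right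
  cases b with
  | true =>
    rw [repairSeq_of_partner (i := i) (b := true) h, hk', hl'] at hl
    have h0 : ¬∃ q, Partner true y q i := by
      rintro ⟨q, hq⟩
      obtain ⟨r, hr⟩ := Matched.right hq
      simp [hk'] at hr
    rw [repairSeq_of_not_partner h0, hk'] at hk
    simp [relabel] at hl hk
    exact hk.symm.trans hl
  | false =>
    rw [repairSeq_of_partner (i := j) (b := false) h, hk', hl'] at hk
    have h0 : ¬∃ q, Partner false y q j := by
      rintro ⟨q, hq⟩
      obtain ⟨r, hr⟩ := Matched.left hq
      simp [hl'] at hr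
    rw [repairSeq_of_not_partner h0, hl'] at hl
    simp [relabel] at hl hk
    exact hk.symm.trans hl

lemma repairSeq_eq_self {b : Bool} {y : ℤ → Symbol M N} (hy : WellMatched y) :
    repairSeq b y = y := by
  funext j
  by_cases h : ∃ i, Partner b y i j
  · obtain ⟨i, hi⟩ := h
    rw [repairSeq_of_partner hi]
    cases b with
    | true =>
      obtain ⟨k, hk⟩ := Matched.left hi
      obtain ⟨l, hl⟩ := Matched.right hi
      rw [hk, hl, ← hy _ _ _ _ hi hk hl]; rfl
    | false =>
      obtain ⟨k, hk⟩ := Matched.left hi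
      obtain ⟨l, hl⟩ := Matched.right hi
      rw [hk, hl, hy _ _ _ _ hi hk hl]; rfl
  · exact repairSeq_of_not_partner h

lemma repairSeq_fullShift (b : Bool) (y : ℤ → Symbol M N) :
    repairSeq b (fullShift y) = fullShift (repairSeq b y) := by
  funext j
  by_cases h : ∃ i, Partner b (fullShift y) i j
  · obtain ⟨i, hi⟩ := h
    rw [repairSeq_of_partner hi]
    exact (repairSeq_of_partner (partner_fullShift_iff.1 hi)).symm
  · rw [repairSeq_of_not_partner h]
    refine (repairSeq_of_not_partner (b := b) (y := y) (j := j + 1) ?_).symm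
    rintro ⟨i, hi⟩
    exact h ⟨i - 1, partner_fullShift_iff.2 (by rwa [sub_add_cancel])⟩

lemma eventually_eqOn {D : Type*} [TopologicalSpace D] [DiscreteTopology D] (y : ℤ → D) {s : Set ℤ}
    (hs : s.Finite) : ∀ᶠ z in nhds y, ∀ k ∈ s, z k = y k :=
  hs.eventually_all.2 fun k _ =>
    ((continuous_apply k).tendsto y).eventually_mem (mem_nhds_discrete.2 (Set.mem_singleton _))

lemma isOpen_setOf_partner (b : Bool) (i j : ℤ) :
    IsOpen {y : ℤ → Symbol M N | Partner b y i j} := by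
  rw [isOpen_iff_eventually]
  intro y hy
  filter_upwards [eventually_eqOn y (Set.finite_uIcc i j)] with z hz
  exact (Partner.congr_iff fun k hk => by rw [hz k hk]).2 hy

lemma measurable_repairSeq (b : Bool) :
    Measurable (repairSeq b : (ℤ → Symbol M N) → ℤ → Symbol M N) := by
  rw [measurable_pi_iff]
  intro j
  refine measurable_to_countable' fun a => ?_
  have hP : ∀ i, MeasurableSet {y : ℤ → Symbol M N | Partner b y i j} := fun i =>
    (isOpen_setOf_partner b i j).measurableSet
  have e : (fun y : ℤ → Symbol M N => repairSeq b y j) ⁻¹' {a} =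
      (⋃ i, {y | Partner b y i j} ∩ {y | relabel (y j) (y i) = a}) ∪
        ((⋂ i, {y | Partner b y i j}ᶜ) ∩ {y | y j = a}) := by
    ext y
    simp only [Set.mem_preimage, Set.mem_singleton_iff, Set.mem_union, Set.mem_iUnion,
      Set.mem_inter_iff, Set.mem_ofPred_eq, Set.mem_iInter, Set.mem_compl_iff]
    by_cases h : ∃ i, Partner b y i j
    · obtain ⟨i, hi⟩ := h
      rw [repairSeq_of_partner hi]
      constructor
      · exact fun h => Or.inl ⟨i, hi, h⟩
      · rintro (⟨i', h1, h2⟩ | ⟨h1, h2⟩)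
        · rwa [h1.unique hi] at h2
        · exact absurd hi (h1 i)
    · rw [repairSeq_of_not_partner h]
      push Not at h
      constructor
      · exact fun h' => Or.inr ⟨h, h'⟩
      · rintro (⟨i', h1, h2⟩ | ⟨h1, h2⟩)
        · exact absurd h1 (h i')
        · exact h2
  rw [e]
  refine (MeasurableSet.iUnion fun i => (hP i).inter ?_).union
    ((MeasurableSet.iInter fun i => (hP i).compl).inter ?_)
  · have : Measurable fun y : ℤ → Symbol M N => (y j, y i) := by fun_prop
    exact this (MeasurableSet.of_discrete (s := {p | relabel p.1 p.2 = a}))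
  · exact (measurable_pi_apply j : Measurable fun y : ℤ → Symbol M N => y j)
      (measurableSet_singleton a)

/-- The weight whose height tends to `∞` on `setAlpha` (`b` true) or on `setBeta` (`b` false). -/
def signedWeight (b : Bool) (a : Symbol M N) : ℤ := bif b then weight a else -weight a

lemma abs_signedWeight_le (b : Bool) (a : Symbol M N) : |signedWeight b a| ≤ 1 := by
  cases b <;> cases a <;> simp [signedWeight, weight]

lemma exists_partner_of_mem_driftSet {b : Bool} {y : ℤ → Symbol M N}
    (hy : y ∈ driftSet (signedWeight b)) {j : ℤ} (hj : ∃ l, y j = bif b then .right l else .left l) :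
    ∃ i, Partner b y i j := by
  obtain ⟨l, hl⟩ := hj
  cases b with
  | true =>
    refine exists_matched_left hl ?_
    have h := hy.2.eventually (eventually_lt_atBot (heightOf weight y j))
    obtain ⟨i, h1, h2⟩ := (h.and (eventually_lt_atBot j)).exists
    exact ⟨i, h2, h1⟩
  | false =>
    refine exists_matched_right hl ?_
    have h := hy.1.eventually (eventually_gt_atTop (-heightOf weight y j))
    obtain ⟨i, h1, h2⟩ := (h.and (eventually_gt_atTop j)).exists
    refine ⟨i, h2, ?_⟩
    have h3 := heightOf_neg weight y i
    change _ < heightOf (fun a => -weight a) y i at h1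
    omega

/-- If `j` has a partner, the new letter depends on the window between the two. If not, drift shows
that the letter at `j` is not of the direction being relabelled, so no nearby sequence has a partner
at `j` either. Without drift, a partner could appear arbitrarily far away in nearby sequences. -/
lemma continuousAt_repairSeq {b : Bool} {y : ℤ → Symbol M N}
    (hy : y ∈ driftSet (signedWeight b)) : ContinuousAt (repairSeq b) y := by
  rw [continuousAt_pi]
  intro j
  rw [ContinuousAt, nhds_discrete (Symbol M N), tendsto_pure]
  by_cases h : ∃ i, Partner b y i j
  · obtain ⟨i, hi⟩ := h
    filter_upwards [eventually_eqOn y (Set.finite_uIcc i j)] with z hz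
    have hi' : Partner b z i j := (Partner.congr_iff fun k hk => by rw [hz k hk]).2 hi
    rw [repairSeq_of_partner hi, repairSeq_of_partner hi', hz j Set.right_mem_uIcc,
      hz i Set.left_mem_uIcc]
  · filter_upwards [eventually_eqOn y (Set.finite_singleton j)] with z hz
    have h1 : ¬∃ l, y j = bif b then .right l else .left l :=
      fun h' => h (exists_partner_of_mem_driftSet hy h')
    have h2 : ¬∃ i, Partner b z i j := by
      rintro ⟨i, hi⟩
      apply h1
      rw [← hz j rfl]
      cases b
      · exact Matched.left hi
      · exact Matched.right hi
    rw [repairSeq_of_not_partner h, repairSeq_of_not_partner h2, hz j rfl]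

/-- The relabelling map as a retraction of the full shift onto the Dyck-Motzkin shift. -/
noncomputable def repair [Nonempty (Fin M)] (b : Bool) (y : ℤ → Symbol M N) : shiftSpace M N :=
  ⟨repairSeq b y, mem_shiftSpace_of_wellMatched (wellMatched_repairSeq b y)⟩

/-- The set `A_α` (`b` true) or `A_β` (`b` false). -/
def driftingPart (M N : ℕ) (b : Bool) : Set (shiftSpace M N) :=
  bif b then setAlpha M N else setBeta M N

lemma mem_driftingPart_iff {b : Bool} {x : shiftSpace M N} :
    x ∈ driftingPart M N b ↔ x.1 ∈ driftSet (signedWeight b) := by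
  cases b with
  | true => rfl
  | false =>
    have e : heightOf (signedWeight false) x.1 = fun i => -height i x := by
      funext i
      exact heightOf_neg weight x.1 i
    change (Tendsto (fun i => height i x) atTop atBot ∧ Tendsto (fun i => height i x) atBot atTop) ↔
      (Tendsto _ _ _ ∧ Tendsto _ _ _)
    rw [e, tendsto_neg_atTop_iff, tendsto_neg_atBot_iff]

variable [Nonempty (Fin M)]

lemma measurable_repair (b : Bool) : Measurable (repair b : _ → shiftSpace M N) :=
  (measurable_repairSeq b).subtype_mk

lemma continuousAt_repair {b : Bool} {y : ℤ → Symbol M N}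
    (hy : y ∈ driftSet (signedWeight b)) : ContinuousAt (repair b : _ → shiftSpace M N) y :=
  (continuousAt_repairSeq hy).codRestrict fun y =>
    mem_shiftSpace_of_wellMatched (wellMatched_repairSeq b y)

lemma repair_val (b : Bool) (x : shiftSpace M N) : repair b x.1 = x :=
  Subtype.ext (repairSeq_eq_self (wellMatched_of_mem_shiftSpace x.2))

lemma repair_fullShift (b : Bool) (y : ℤ → Symbol M N) :
    repair b (fullShift y) = shift M N (repair b y) :=
  Subtype.ext (repairSeq_fullShift b y)

lemma repair_mem_driftingPart_iff {b : Bool} {y : ℤ → Symbol M N} :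
    repair b y ∈ driftingPart M N b ↔ y ∈ driftSet (signedWeight b) := by
  rw [mem_driftingPart_iff]
  have e : heightOf (signedWeight b) (repair b y).1 = heightOf (signedWeight b) y :=
    heightOf_congr fun k => by simp only [signedWeight, repair, weight_repairSeq]
  simp only [driftSet, Set.mem_ofPred_eq, e]

end Relabel

/-! ### Birkhoff sums and the sign of the mean -/

section Birkhoff

variable {α : Type*} {T : α → α}

/-- The maximum of `0` and the first `n` Birkhoff sums. -/
noncomputable def birkhoffMax (T : α → α) (f : α → ℝ) : ℕ → α → ℝ
  | 0, _ => 0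
  | n + 1, x => max 0 (f x + birkhoffMax T f n (T x))

lemma birkhoffMax_nonneg (f : α → ℝ) (n : ℕ) (x : α) : 0 ≤ birkhoffMax T f n x := by
  cases n
  · exact le_rfl
  · exact le_max_left _ _

lemma birkhoffMax_le_succ (f : α → ℝ) (n : ℕ) (x : α) :
    birkhoffMax T f n x ≤ birkhoffMax T f (n + 1) x := by
  induction n generalizing x with
  | zero => exact birkhoffMax_nonneg f 1 x
  | succ n ih =>
    change max 0 (f x + birkhoffMax T f n (T x)) ≤ max 0 (f x + birkhoffMax T f (n + 1) (T x))
    gcongr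
    exact ih (T x)

lemma birkhoffSum_le_birkhoffMax (f : α → ℝ) (n : ℕ) (x : α) :
    birkhoffSum T f n x ≤ birkhoffMax T f n x := by
  induction n generalizing x with
  | zero => simp [birkhoffMax]
  | succ n ih =>
    rw [birkhoffSum_succ']
    exact (add_le_add_right (ih (T x)) _).trans (le_max_right _ _)

variable [MeasurableSpace α] {μ : Measure α}

lemma integrable_birkhoffMax (hT : MeasurePreserving T μ μ) {f : α → ℝ} (hf : Integrable f μ)
    (n : ℕ) : Integrable (birkhoffMax T f n) μ := by
  induction n with
  | zero => exact integrable_zero _ _ _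
  | succ n ih =>
    exact (integrable_zero α ℝ μ).sup (hf.add (hT.integrable_comp_of_integrable ih))

lemma measurable_birkhoffMax (hT : Measurable T) {f : α → ℝ} (hf : Measurable f)
    (n : ℕ) : Measurable (birkhoffMax T f n) := by
  induction n with
  | zero => exact measurable_const
  | succ n ih => exact measurable_const.max (hf.add (ih.comp hT))

/-- The Birkhoff sums of a function of negative mean over an ergodic system are bounded above. -/
lemma ae_bddAbove_birkhoffSum [IsProbabilityMeasure μ] (hT : Ergodic T μ) {f : α → ℝ}
    (hfm : Measurable f) (hf : Integrable f μ) (hneg : ∫ x, f x ∂μ < 0) :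
    ∀ᵐ x ∂μ, ∃ K : ℝ, ∀ n, birkhoffSum T f n x ≤ K := by
  have hmono : ∀ x, Monotone fun n => birkhoffMax T f n x := fun x =>
    monotone_nat_of_le_succ fun n => birkhoffMax_le_succ f n x
  let A : Set α := {x | ∀ K : ℕ, ∃ n, (K : ℝ) < birkhoffMax T f n x}
  have hA : MeasurableSet A := by
    have e : A = ⋂ K : ℕ, ⋃ n, {x | (K : ℝ) < birkhoffMax T f n x} := by ext; simp [A]
    rw [e]
    exact MeasurableSet.iInter fun K => MeasurableSet.iUnion fun n =>
      measurableSet_lt measurable_const (measurable_birkhoffMax hT.measurable hfm n)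
  have hinv : T ⁻¹' A = A := by
    ext x
    constructor
    · intro hx K
      obtain ⟨L, hL⟩ := exists_nat_gt ((K : ℝ) - f x)
      obtain ⟨n, hn⟩ := hx L
      refine ⟨n + 1, lt_of_lt_of_le ?_ (le_max_right _ _)⟩
      linarith
    · intro hx K
      obtain ⟨L, hL⟩ := exists_nat_gt ((K : ℝ) + |f x|)
      obtain ⟨n, hn⟩ := hx L
      refine ⟨n, ?_⟩
      have h1 := hn.trans_le (birkhoffMax_le_succ f n x)
      have h2 := le_abs_self (f x)
      have h3 : (0 : ℝ) ≤ K := K.cast_nonneg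
      have h4 := abs_nonneg (f x)
      rcases lt_max_iff.1 h1 with h | h <;> linarith
  rcases hT.toPreErgodic.ae_mem_or_ae_notMem hA hinv with h | h
  · exfalso
    -- Maximal ergodic argument. The integrand equals `birkhoffMax (n + 1) - birkhoffMax n ∘ T`,
    -- whose integral is nonnegative by monotonicity in `n` and invariance. If the maxima are
    -- unbounded, it is eventually `f`, so the mean of `f` would be nonnegative.
    have hlim : Tendsto (fun n => ∫ x, max (-birkhoffMax T f n (T x)) (f x) ∂μ) atTop
        (nhds (∫ x, f x ∂μ)) := by
      refine tendsto_integral_of_dominated_convergence (fun x => |f x|) (fun n => ?_) hf.abs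
        (fun n => ?_) ?_
      · exact (((measurable_birkhoffMax hT.measurable hfm n).comp
          hT.measurable).neg.max hfm).aestronglyMeasurable
      · refine Eventually.of_forall fun x => ?_
        rw [Real.norm_eq_abs, abs_le]
        have := birkhoffMax_nonneg (T := T) f n (T x)
        exact ⟨(neg_abs_le _).trans (le_max_right _ _),
          max_le (by linarith [abs_nonneg (f x)]) (le_abs_self _)⟩
      · filter_upwards [h] with x hx
        rw [← hinv] at hx
        obtain ⟨K, hK⟩ := exists_nat_gt (-f x)
        obtain ⟨n, hn⟩ := hx K
        refine tendsto_const_nhds.congr' ?_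
        filter_upwards [eventually_ge_atTop n] with m hm
        have := hmono (T x) hm
        simp only at this
        rw [max_eq_right]
        linarith
    have hnonneg : ∀ n, 0 ≤ ∫ x, max (-birkhoffMax T f n (T x)) (f x) ∂μ := by
      intro n
      have h1 := integrable_birkhoffMax hT.toMeasurePreserving hf n
      have h2 := integrable_birkhoffMax hT.toMeasurePreserving hf (n + 1)
      have h3 := hT.toMeasurePreserving.integrable_comp_of_integrable h1
      have e : ∀ x, max (-birkhoffMax T f n (T x)) (f x) =
          birkhoffMax T f (n + 1) x - (birkhoffMax T f n ∘ T) x := by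
        intro x
        rw [birkhoffMax, Function.comp_apply, ← max_sub_sub_right]
        simp
      simp_rw [e]
      rw [integral_sub h2 h3, sub_nonneg]
      calc ∫ x, (birkhoffMax T f n ∘ T) x ∂μ = ∫ x, birkhoffMax T f n x ∂μ := by
            conv_rhs => rw [← hT.toMeasurePreserving.map_eq]
            exact (integral_map_of_stronglyMeasurable hT.measurable
              (measurable_birkhoffMax hT.measurable hfm n).stronglyMeasurable).symm
        _ ≤ _ := integral_mono h1 h2 fun x => birkhoffMax_le_succ f n x
    exact absurd (ge_of_tendsto' hlim hnonneg) (not_le.2 hneg)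
  · filter_upwards [h] with x hx
    simp only [A, Set.mem_ofPred_eq, not_forall, not_exists, not_lt] at hx
    obtain ⟨K, hK⟩ := hx
    exact ⟨K, fun n => (birkhoffSum_le_birkhoffMax f n x).trans (hK n)⟩

/-- If the Birkhoff sums of an integer-valued function bounded by one tend to infinity, then the
function has positive mean. -/
lemma integral_pos_of_tendsto_birkhoffSum [IsProbabilityMeasure μ] (hT : MeasurePreserving T μ μ)
    {f : α → ℤ} (hfm : Measurable f) (hf : ∀ x, |f x| ≤ 1)
    (h : ∀ᵐ x ∂μ, Tendsto (fun n => birkhoffSum T f n x) atTop atTop) :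
    0 < ∫ x, (f x : ℝ) ∂μ := by
  -- The empty sum is included, so `m ≤ 0` wherever the sums are bounded below, which is almost
  -- everywhere.
  let m : α → ℤ := fun x => ⨅ n, birkhoffSum T f n x
  have hSm : ∀ n, Measurable (birkhoffSum T f n) := fun n => by
    unfold birkhoffSum
    exact Finset.measurable_fun_sum _ fun k _ => hfm.comp (hT.measurable.iterate k)
  have hm : Measurable m := Measurable.iInf hSm
  have hbdd : ∀ᵐ x ∂μ, BddBelow (Set.range fun n => birkhoffSum T f n x) :=
    h.mono fun x hx => bddBelow_range_of_tendsto_atTop_atTop hx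
  have hbddT : ∀ᵐ x ∂μ, BddBelow (Set.range fun n => birkhoffSum T f n (T x)) :=
    hT.quasiMeasurePreserving.ae hbdd
  have hmT : ∀ᵐ x ∂μ, m (T x) ≤ 0 := hbddT.mono fun x hx => (ciInf_le hx 0).trans (by simp)
  -- Since `m = min 0 (f + m ∘ T)`, one has `m ∘ T - m = d - f`: up to a coboundary, `f` is the
  -- nonnegative function `d`.
  let d : α → ℤ := fun x => max 0 (f x + m (T x))
  have hdm : Measurable d := measurable_const.max (hfm.add (hm.comp hT.measurable))
  have hmeq : ∀ᵐ x ∂μ, m x = min 0 (f x + m (T x)) := by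
    filter_upwards [hbdd, hbddT] with x h1 h2
    apply le_antisymm
    · refine le_min ((ciInf_le h1 0).trans (by simp)) ?_
      have : m x - f x ≤ m (T x) := le_ciInf fun n => by
        have h3 : m x ≤ _ := ciInf_le h1 (n + 1)
        simp only [birkhoffSum_succ'] at h3
        omega
      omega
    · refine le_ciInf fun n => ?_
      cases n with
      | zero => simp
      | succ n =>
        refine (min_le_right _ _).trans ?_
        rw [birkhoffSum_succ']
        have h3 : m (T x) ≤ _ := ciInf_le h2 n
        omega
  have hdeq : ∀ᵐ x ∂μ, (m (T x) : ℝ) - m x = d x - f x := by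
    filter_upwards [hmeq] with x hx
    have : m (T x) - m x = d x - f x := by
      rw [hx]; simp only [d]; omega
    exact_mod_cast this
  have hd : ∀ᵐ x ∂μ, 0 ≤ d x ∧ d x ≤ 1 := by
    filter_upwards [hmT] with x hx
    have := (abs_le.1 (hf x)).2
    exact ⟨le_max_left _ _, max_le (by omega) (by omega)⟩
  have hbound : ∀ᵐ x ∂μ, |(m (T x) : ℝ) - m x| ≤ 2 := by
    filter_upwards [hdeq, hd] with x h1 h2
    rw [h1]
    have h3 := abs_le.1 (hf x)
    have : |d x - f x| ≤ 2 := abs_le.2 ⟨by omega, by omega⟩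
    exact_mod_cast this
  have hfR : Measurable fun x => (f x : ℝ) := measurable_from_top.comp hfm
  have hmR : Measurable fun x => (m x : ℝ) := measurable_from_top.comp hm
  have hdR : Measurable fun x => (d x : ℝ) := measurable_from_top.comp hdm
  have hfi : Integrable (fun x => (f x : ℝ)) μ :=
    Integrable.of_bound hfR.aestronglyMeasurable 1 (Eventually.of_forall fun x => by
      rw [Real.norm_eq_abs]; exact_mod_cast hf x)
  have hdi : Integrable (fun x => (d x : ℝ)) μ :=
    Integrable.of_bound hdR.aestronglyMeasurable 1 (hd.mono fun x hx => by
      rw [Real.norm_eq_abs]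
      have : |d x| ≤ 1 := abs_le.2 ⟨by omega, hx.2⟩
      exact_mod_cast this)
  -- Integrability of `m` is not known, but the coboundary is bounded; truncating `m` from below
  -- makes both terms integrable with equal integrals.
  have hzero : ∫ x, ((m (T x) : ℝ) - m x) ∂μ = 0 := by
    have hlim : Tendsto (fun K : ℕ => ∫ x, (max (m (T x) : ℝ) (-K) - max (m x : ℝ) (-K)) ∂μ) atTop
        (nhds (∫ x, ((m (T x) : ℝ) - m x) ∂μ)) := by
      refine tendsto_integral_of_dominated_convergence (fun _ => 2) (fun K => ?_)
        (integrable_const _) (fun K => ?_) (Eventually.of_forall fun x => ?_)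
      · exact (((hmR.comp hT.measurable).max measurable_const).sub
          (hmR.max measurable_const)).aestronglyMeasurable
      · filter_upwards [hbound] with x hx
        exact (abs_max_sub_max_le_abs _ _ _).trans hx
      · refine tendsto_const_nhds.congr' ?_
        obtain ⟨K₁, h₁⟩ := exists_nat_gt (-(m x : ℝ))
        obtain ⟨K₂, h₂⟩ := exists_nat_gt (-(m (T x) : ℝ))
        filter_upwards [eventually_ge_atTop K₁, eventually_ge_atTop K₂] with K hK₁ hK₂
        have h3 : (K₁ : ℝ) ≤ K := by exact_mod_cast hK₁
        have h4 : (K₂ : ℝ) ≤ K := by exact_mod_cast hK₂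
        rw [max_eq_left (by linarith), max_eq_left (by linarith)]
    refine tendsto_nhds_unique hlim (tendsto_const_nhds.congr fun K => ?_)
    have hKm : Measurable fun x => max (m x : ℝ) (-K) := hmR.max measurable_const
    have hKi : Integrable (fun x => max (m x : ℝ) (-K)) μ := by
      refine Integrable.of_bound hKm.aestronglyMeasurable K ?_
      filter_upwards [hbdd] with x hx
      have h1 : m x ≤ 0 := (ciInf_le hx 0).trans (by simp)
      have h2 : (m x : ℝ) ≤ 0 := by exact_mod_cast h1
      have h3 : (0 : ℝ) ≤ K := K.cast_nonneg
      rw [Real.norm_eq_abs, abs_le]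
      exact ⟨le_max_right _ _, max_le (by linarith) (by linarith)⟩
    have hKTi : Integrable (fun x => max (m (T x) : ℝ) (-K)) μ :=
      hT.integrable_comp_of_integrable hKi
    rw [integral_sub hKTi hKi, eq_comm, sub_eq_zero]
    conv_rhs => rw [← hT.map_eq]
    rw [integral_map hT.measurable.aemeasurable hKm.aestronglyMeasurable]
  have heq : ∫ x, (f x : ℝ) ∂μ = ∫ x, (d x : ℝ) ∂μ := by
    rw [integral_congr_ae hdeq, integral_sub hdi hfi] at hzero
    linarith
  have hd0 : 0 ≤ᵐ[μ] fun x => (d x : ℝ) := hd.mono fun x hx => by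
    simpa using hx.1
  rw [heq]
  refine (integral_nonneg_of_ae hd0).lt_of_ne fun hc => ?_
  -- Zero mean would force `d = 0` along almost every orbit. Then each Birkhoff sum is followed by a
  -- later one that is no larger, so starting from the empty sum the values return to `≤ 0` forever.
  have hdz : ∀ᵐ x ∂μ, d x = 0 :=
    ((integral_eq_zero_iff_of_nonneg_ae hd0 hdi).1 hc.symm).mono fun x hx => by simpa using hx
  have hall : ∀ᵐ x ∂μ, ∀ n : ℕ, d (T^[n] x) = 0 ∧
      BddBelow (Set.range fun k => birkhoffSum T f k (T (T^[n] x))) := by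
    rw [ae_all_iff]
    intro n
    exact ((hT.iterate n).quasiMeasurePreserving.ae (hdz.and hbddT))
  obtain ⟨x, hx, hxT⟩ := (hall.and h).exists
  have hstep : ∀ n : ℕ, ∃ k > n, birkhoffSum T f k x ≤ birkhoffSum T f n x := by
    intro n
    obtain ⟨h1, h2⟩ := hx n
    -- The infimum is attained because the sums are integers.
    obtain ⟨k, hk⟩ : ∃ k, birkhoffSum T f k (T (T^[n] x)) = m (T (T^[n] x)) :=
      Int.csInf_mem (Set.range_nonempty _) h2
    refine ⟨n + (k + 1), by omega, ?_⟩
    rw [birkhoffSum_add, birkhoffSum_succ', hk]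
    have := le_max_right 0 (f (T^[n] x) + m (T (T^[n] x)))
    change _ ≤ d (T^[n] x) at this
    omega
  have hfreq : ∀ n : ℕ, ∃ k ≥ n, birkhoffSum T f k x ≤ 0 := by
    intro n
    induction n with
    | zero => exact ⟨0, le_rfl, by simp⟩
    | succ n ih =>
      obtain ⟨k, hk, hk'⟩ := ih
      obtain ⟨l, hl, hl'⟩ := hstep k
      exact ⟨l, by omega, hl'.trans hk'⟩
  obtain ⟨n, hn⟩ := eventually_atTop.1 (hxT.eventually (eventually_gt_atTop 0))
  obtain ⟨k, hk, hk'⟩ := hfreq n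
  exact absurd (hn k hk) (not_lt.2 hk')

end Birkhoff

/-! ### Drift on the full shift and positive mean weight -/

section FullShift

variable {D : Type*} [MeasurableSpace D]

lemma measurable_fullShift : Measurable (fullShift : (ℤ → D) → ℤ → D) :=
  measurable_pi_lambda _ fun i => measurable_pi_apply (i + 1)

/-- The left shift as a measurable equivalence. -/
def fullShiftEquiv (D : Type*) [MeasurableSpace D] : (ℤ → D) ≃ᵐ (ℤ → D) where
  toFun := fullShift
  invFun y i := y (i - 1)
  left_inv y := by funext i; simp [fullShift]
  right_inv y := by funext i; simp [fullShift]
  measurable_toFun := measurable_fullShift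
  measurable_invFun := measurable_pi_lambda _ fun i => measurable_pi_apply (i - 1)

lemma fullShift_iterate {D : Type*} (n : ℕ) (y : ℤ → D) (i : ℤ) : fullShift^[n] y i = y (i + n) := by
  induction n generalizing y with
  | zero => simp
  | succ n ih =>
    rw [Function.iterate_succ_apply, ih, fullShift]
    congr 1; push_cast; ring

lemma fullShiftEquiv_symm_iterate (n : ℕ) (y : ℤ → D) (i : ℤ) :
    (fullShiftEquiv D).symm^[n] y i = y (i - n) := by
  induction n generalizing y with
  | zero => simp
  | succ n ih =>
    rw [Function.iterate_succ_apply, ih]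
    change y (i - n - 1) = _
    congr 1; push_cast; ring

lemma heightOf_natCast {D : Type*} (g : D → ℤ) (y : ℤ → D) (n : ℕ) :
    heightOf g y n = ∑ k ∈ Finset.range n, g (y k) := by
  induction n with
  | zero => simp
  | succ n ih => rw [Finset.sum_range_succ, ← ih, Nat.cast_succ, heightOf_succ]

lemma heightOf_neg_natCast {D : Type*} (g : D → ℤ) (y : ℤ → D) (n : ℕ) :
    heightOf g y (-n) = -∑ k ∈ Finset.range n, g (y (-1 - k)) := by
  induction n with
  | zero => simp
  | succ n ih =>
    rw [Finset.sum_range_succ, neg_add, ← ih]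
    have h := heightOf_succ g y (-((n + 1 : ℕ) : ℤ))
    rw [show -((n + 1 : ℕ) : ℤ) + 1 = -n by push_cast; ring] at h
    rw [show (-1 - n : ℤ) = -((n + 1 : ℕ) : ℤ) by push_cast; ring]
    omega

variable [DiscreteMeasurableSpace D]

lemma measurable_heightOf (g : D → ℤ) (i : ℤ) : Measurable fun y : ℤ → D => heightOf g y i :=
  (Finset.measurable_fun_sum _ fun j _ => (Measurable.of_discrete (f := g)).comp
    (measurable_pi_apply j)).sub
  (Finset.measurable_fun_sum _ fun j _ => (Measurable.of_discrete (f := g)).comp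
    (measurable_pi_apply j))

lemma measurableSet_driftSet (g : D → ℤ) : MeasurableSet (driftSet g) :=
  (measurableSet_tendsto atTop (measurable_heightOf g)).inter
    (measurableSet_tendsto atBot (measurable_heightOf g))

variable {μ : Measure (ℤ → D)} [IsProbabilityMeasure μ]

/-- For an ergodic measure of positive mean weight, the height almost surely has a drift. -/
lemma ae_mem_driftSet_of_integral_pos (hμ : Ergodic fullShift μ) {g : D → ℤ}
    (hg : ∀ a, |g a| ≤ 1) (hpos : 0 < ∫ y, (g (y 0) : ℝ) ∂μ) : ∀ᵐ y ∂μ, y ∈ driftSet g := by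
  -- With half the mean, `c - g` has negative mean, and bounded Birkhoff sums turn into linear
  -- growth of the height at rate at least `c`.
  set c : ℝ := (∫ y, (g (y 0) : ℝ) ∂μ) / 2 with hc
  have hc0 : 0 < c := by positivity
  have hmeas : ∀ i : ℤ, Measurable fun y : ℤ → D => (g (y i) : ℝ) := fun i =>
    (Measurable.of_discrete (f := fun a => (g a : ℝ))).comp (measurable_pi_apply i)
  have hint : ∀ i : ℤ, Integrable (fun y : ℤ → D => (g (y i) : ℝ)) μ := fun i =>
    Integrable.of_bound (hmeas i).aestronglyMeasurable 1 (Eventually.of_forall fun y => by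
      rw [Real.norm_eq_abs]; exact_mod_cast hg (y i))
  have hμ' : Ergodic (fullShiftEquiv D).symm μ := Ergodic.symm (e := fullShiftEquiv D) hμ
  have hstat : ∫ y, (g (y (-1)) : ℝ) ∂μ = ∫ y, (g (y 0) : ℝ) ∂μ := by
    conv_rhs => rw [← hμ'.toMeasurePreserving.map_eq]
    exact (integral_map_of_stronglyMeasurable hμ'.measurable (hmeas 0).stronglyMeasurable).symm
  have h1 := ae_bddAbove_birkhoffSum hμ (f := fun y => c - g (y 0))
    (measurable_const.sub (hmeas 0)) ((integrable_const c).sub (hint 0)) (by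
      rw [integral_sub (integrable_const c) (hint 0)]; simp; linarith)
  -- The past uses the inverse shift; the height at `-n` sums the letters from `-1` down to `-n`, so
  -- coordinate `-1` is the one to read.
  have h2 := ae_bddAbove_birkhoffSum hμ' (f := fun y => c - g (y (-1)))
    (measurable_const.sub (hmeas (-1))) ((integrable_const c).sub (hint (-1))) (by
      rw [integral_sub (integrable_const c) (hint (-1)), hstat]; simp; linarith)
  filter_upwards [h1, h2] with y ⟨K, hK⟩ ⟨L, hL⟩
  have e1 : ∀ n : ℕ, c * n - K ≤ heightOf g y n := by
    intro n
    have h := hK n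
    simp only [birkhoffSum, fullShift_iterate, Finset.sum_sub_distrib, Finset.sum_const,
      Finset.card_range, nsmul_eq_mul, zero_add] at h
    rw [heightOf_natCast]
    push_cast
    linarith
  have e2 : ∀ n : ℕ, (heightOf g y (-n) : ℝ) ≤ L - c * n := by
    intro n
    have h := hL n
    simp only [birkhoffSum, fullShiftEquiv_symm_iterate, Finset.sum_sub_distrib, Finset.sum_const,
      Finset.card_range, nsmul_eq_mul] at h
    rw [heightOf_neg_natCast]
    push_cast
    linarith
  constructor
  · rw [← tendsto_intCast_atTop_iff (R := ℝ)]
    have hlin : Tendsto (fun i : ℤ => c * (i : ℝ) - K) atTop atTop :=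
      tendsto_atTop_add_const_right _ _ (tendsto_intCast_atTop_atTop.const_mul_atTop hc0)
    refine tendsto_atTop_mono' _ ?_ hlin
    filter_upwards [eventually_ge_atTop 0] with i hi
    lift i to ℕ using hi
    exact_mod_cast e1 i
  · rw [← tendsto_intCast_atBot_iff (R := ℝ)]
    have hlin : Tendsto (fun i : ℤ => c * (i : ℝ) + L) atBot atBot :=
      tendsto_atBot_add_const_right _ _ ((tendsto_intCast_atBot_iff.2 tendsto_id).const_mul_atBot hc0)
    refine tendsto_atBot_mono' _ ?_ hlin
    filter_upwards [eventually_le_atBot 0] with i hi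
    obtain ⟨n, rfl⟩ : ∃ n : ℕ, i = -n := ⟨(-i).toNat, by omega⟩
    have := e2 n
    push_cast
    linarith

lemma integral_pos_of_ae_mem_driftSet (hμ : MeasurePreserving fullShift μ μ) {g : D → ℤ}
    (hg : ∀ a, |g a| ≤ 1) (h : ∀ᵐ y ∂μ, y ∈ driftSet g) : 0 < ∫ y, (g (y 0) : ℝ) ∂μ := by
  refine integral_pos_of_tendsto_birkhoffSum hμ (f := fun y => g (y 0))
    ((Measurable.of_discrete (f := g)).comp (measurable_pi_apply 0)) (fun y => hg (y 0)) ?_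
  filter_upwards [h] with y hy
  refine (hy.1.comp tendsto_natCast_atTop_atTop).congr fun n => ?_
  simp [birkhoffSum, fullShift_iterate, heightOf_natCast]

end FullShift

/-! ### Ergodicity of Bernoulli shifts -/

section Bernoulli

variable {S : Type*} [MeasurableSpace S] (π : Measure S) [IsProbabilityMeasure π]

lemma measurePreserving_fullShift_infinitePi :
    MeasurePreserving (fullShift : (ℤ → S) → ℤ → S) (Measure.infinitePi fun _ => π)
      (Measure.infinitePi fun _ => π) := by
  refine ⟨measurable_fullShift, Measure.eq_infinitePi _ fun s t ht => ?_⟩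
  rw [Measure.map_apply measurable_fullShift (.pi s.countable_toSet fun _ _ => ht _)]
  have e : (fullShift : (ℤ → S) → ℤ → S) ⁻¹' (s : Set ℤ).pi t =
      ((s.map (Equiv.addRight (1 : ℤ)).toEmbedding : Finset ℤ) : Set ℤ).pi fun i => t (i - 1) := by
    ext y
    simp only [fullShift, Set.mem_pi, Set.mem_preimage, Finset.mem_coe, Finset.mem_map_equiv,
      Equiv.addRight_symm, Equiv.coe_addRight]
    refine ⟨fun h i hi => ?_, fun h i hi => ?_⟩
    · simpa [← sub_eq_add_neg] using h _ hi
    · simpa using h (i + 1) (by simpa using hi)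
  rw [e, Measure.infinitePi_pi _ fun i _ => ht _, Finset.prod_map]
  simp

/-- Independence of events depending on disjoint finite sets of coordinates. -/
lemma infinitePi_inter_of_disjoint {I J : Finset ℤ} (hIJ : Disjoint I J)
    {A : Set (I → S)} {B : Set (J → S)} (hA : MeasurableSet A) (hB : MeasurableSet B) :
    Measure.infinitePi (fun _ : ℤ => π) (I.restrict ⁻¹' A ∩ J.restrict ⁻¹' B) =
      Measure.infinitePi (fun _ => π) (I.restrict ⁻¹' A) *
        Measure.infinitePi (fun _ => π) (J.restrict ⁻¹' B) := by
  have h := ProbabilityTheory.iIndepFun_infinitePi (P := fun _ : ℤ => π) (X := fun _ x => x)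
    (fun _ => measurable_id)
  exact (h.indepFun_finset I J hIJ fun i => measurable_pi_apply i).measure_inter_preimage_eq_mul
    _ _ hA hB

/-- An invariant set `s` is approximated by a cylinder `t`. A far translate of `t` is independent of
`t` and approximates `s` as well, so `P s ≈ P (t ∩ translate) = (P t)² ≈ (P s)²`, whence `P s` is
zero or one. -/
lemma ergodic_fullShift_infinitePi :
    Ergodic (fullShift : (ℤ → S) → ℤ → S) (Measure.infinitePi fun _ => π) := by
  have hT := measurePreserving_fullShift_infinitePi π
  set P : Measure (ℤ → S) := Measure.infinitePi fun _ => π with hP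
  refine ⟨hT, ⟨fun {s} hs hinv => ?_⟩⟩
  have hinvn : ∀ n : ℕ, fullShift^[n] ⁻¹' s = s := fun n => by
    rw [Set.preimage_iterate_eq]; exact Function.iterate_fixed hinv n
  have key : P.real s = P.real s * P.real s := by
    refine eq_of_forall_dist_le fun ε hε => ?_
    rw [Real.dist_eq]
    obtain ⟨t, htC, ht⟩ := exists_measure_symmDiff_lt_of_generateFrom_isSetRing (μ := P)
      isSetRing_measurableCylinders ⟨{Set.univ}, Set.countable_singleton _, by
        simpa using univ_mem_measurableCylinders fun _ : ℤ => S, by simp⟩ generateFrom_measurableCylinders.symm hs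
      (ε := ENNReal.ofReal (ε / 4)) (by simpa using hε)
    obtain ⟨I, A, hA, rfl⟩ := (mem_measurableCylinders _).1 htC
    set t : Set (ℤ → S) := cylinder I A with htdef
    have htm : MeasurableSet t := MeasurableSet.cylinder I hA
    have ht' : P.real (symmDiff t s) ≤ ε / 4 :=
      ENNReal.toReal_le_of_le_ofReal (by positivity) ht.le
    -- A translation longer than the spread of `I` separates the two coordinate sets.
    obtain ⟨n, hn⟩ : ∃ n : ℕ, ∀ i ∈ I, ∀ j ∈ I, i + n ≠ j := by
      obtain ⟨b, hb⟩ := I.bddAbove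
      obtain ⟨a, ha⟩ := I.bddBelow
      refine ⟨(b - a + 1).toNat, fun i hi j hj h => ?_⟩
      have := hb hj
      have := ha hi
      omega
    have hshift : P.real (symmDiff (fullShift^[n] ⁻¹' t) s) ≤ ε / 4 := by
      conv_lhs => rw [← hinvn n]
      rw [← Set.preimage_symmDiff, (hT.iterate n).measureReal_preimage
        (htm.symmDiff hs).nullMeasurableSet]
      exact ht'
    have hmul : P.real (t ∩ fullShift^[n] ⁻¹' t) = P.real t * P.real t := by
      let J : Finset ℤ := I.map (Equiv.addRight (n : ℤ)).toEmbedding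
      have hmem : ∀ i : I, (i : ℤ) + n ∈ J := fun i => Finset.mem_map.2 ⟨i, i.2, rfl⟩
      let B : Set (J → S) := (fun z (i : I) => z ⟨(i : ℤ) + n, hmem i⟩) ⁻¹' A
      have hB : MeasurableSet B :=
        (measurable_pi_lambda _ fun i => measurable_pi_apply _) hA
      have e : fullShift^[n] ⁻¹' t = J.restrict ⁻¹' B := by
        ext y
        simp only [htdef, cylinder, B, Set.mem_preimage]
        have : I.restrict (fullShift^[n] y) =
            fun i : I => J.restrict y ⟨(i : ℤ) + n, hmem i⟩ := by
          funext i
          simp [fullShift_iterate]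
        rw [this]
      have hdisj : Disjoint I J := by
        rw [Finset.disjoint_left]
        intro j hj hj'
        obtain ⟨i, hi, hij⟩ := Finset.mem_map.1 hj'
        exact hn i hi j hj hij
      have h := infinitePi_inter_of_disjoint π hdisj hA hB
      rw [← e] at h
      rw [measureReal_def, measureReal_def, ← ENNReal.toReal_mul]
      congr 1
      exact h.trans (by rw [(hT.iterate n).measure_preimage htm.nullMeasurableSet]; rfl)
    have h1 : |P.real t - P.real s| ≤ ε / 4 :=
      (abs_measureReal_sub_le_measureReal_symmDiff htm.nullMeasurableSet
        hs.nullMeasurableSet).trans ht'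
    have hsub : symmDiff (t ∩ fullShift^[n] ⁻¹' t) s ⊆
        symmDiff t s ∪ symmDiff (fullShift^[n] ⁻¹' t) s := by
      intro y hy
      simp only [Set.mem_symmDiff, Set.mem_inter_iff, Set.mem_union] at hy ⊢
      tauto
    have hnm := (hT.measurable.iterate n) htm
    have h2 : |P.real (t ∩ fullShift^[n] ⁻¹' t) - P.real s| ≤ ε / 4 + ε / 4 :=
      (abs_measureReal_sub_le_measureReal_symmDiff (htm.inter hnm).nullMeasurableSet
        hs.nullMeasurableSet).trans (((measureReal_mono hsub).trans
          (measureReal_union_le _ _)).trans (add_le_add ht' hshift))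
    rw [hmul] at h2
    have h3 : P.real s ≤ 1 := measureReal_le_one
    have h4 : P.real t ≤ 1 := measureReal_le_one
    have h5 : 0 ≤ P.real s := measureReal_nonneg
    have h6 : 0 ≤ P.real t := measureReal_nonneg
    rw [abs_le] at h1 h2 ⊢
    constructor <;> nlinarith
  have h01 : P.real s = 0 ∨ P.real s = 1 := by
    rcases eq_or_ne (P.real s) 0 with h | h
    · exact Or.inl h
    · exact Or.inr (mul_left_cancel₀ h (by rw [← key, mul_one]))
  rw [eventuallyConst_set']
  rcases h01 with h | h
  · left
    rw [ae_eq_empty]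
    exact (measureReal_eq_zero_iff).1 h
  · right
    rw [ae_eq_univ, prob_compl_eq_zero_iff hs]
    rwa [measureReal_def, ENNReal.toReal_eq_one_iff] at h

end Bernoulli

/-! ### The restarted sequence as an equivariant function of independent data -/

section Restart

variable {D : Type*}

/-- The data attached to a time: a clock value and one sequence from each of two sources. -/
abbrev Site (D : Type*) : Type _ := unitInterval × ((ℤ → D) × (ℤ → D))

/-- The sequence started afresh at time `m` with the data `s`; the second source is chosen if the
clock value is below `b`. -/
noncomputable def freshSeq (b : unitInterval) (s : Site D) (m i : ℤ) : D :=
  if s.1 < b then s.2.2 (i - m) else s.2.1 (i - m)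

open Classical in
/-- Follow at each time the sequence started at the last time whose clock value was below `a`. -/
noncomputable def restart (a b : unitInterval) (ω : ℤ → Site D) (n : ℤ) : D :=
  if h : ∃ k : ℕ, (ω (n - k)).1 < a then freshSeq b (ω (n - Nat.find h)) (n - Nat.find h) n
  else (ω n).2.1 0

/-- The last time before or at `n` whose clock value is below `a` is `m`. -/
def LastRestart (a : unitInterval) (ω : ℤ → Site D) (m n : ℤ) : Prop :=
  m ≤ n ∧ (ω m).1 < a ∧ ∀ i, m < i → i ≤ n → ¬(ω i).1 < a

lemma exists_lastRestart_iff {a : unitInterval} {ω : ℤ → Site D} {n : ℤ} :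
    (∃ m, LastRestart a ω m n) ↔ ∃ k : ℕ, (ω (n - k)).1 < a := by
  classical
  constructor
  · rintro ⟨m, h1, h2, -⟩
    exact ⟨(n - m).toNat, by rwa [show n - ((n - m).toNat : ℤ) = m by omega]⟩
  · intro h
    refine ⟨n - Nat.find h, by omega, Nat.find_spec h, fun i hi hi' => ?_⟩
    have := Nat.find_min h (m := (n - i).toNat) (by omega)
    rwa [show n - ((n - i).toNat : ℤ) = i by omega] at this

lemma LastRestart.unique {a : unitInterval} {ω : ℤ → Site D} {m m' n : ℤ}
    (h : LastRestart a ω m n) (h' : LastRestart a ω m' n) : m = m' := by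
  rcases lt_trichotomy m m' with hlt | heq | hlt
  · exact absurd h'.2.1 (h.2.2 _ hlt h'.1)
  · exact heq
  · exact absurd h.2.1 (h'.2.2 _ hlt h.1)

lemma restart_of_lastRestart {a b : unitInterval} {ω : ℤ → Site D} {m n : ℤ}
    (h : LastRestart a ω m n) : restart a b ω n = freshSeq b (ω m) m n := by
  classical
  have hex := exists_lastRestart_iff.1 ⟨m, h⟩
  have hm : LastRestart a ω (n - Nat.find hex) n := by
    refine ⟨by omega, Nat.find_spec hex, fun i hi hi' => ?_⟩
    have := Nat.find_min hex (m := (n - i).toNat) (by omega)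
    rwa [show n - ((n - i).toNat : ℤ) = i by omega] at this
  rw [h.unique hm, restart, dif_pos hex]

lemma restart_of_not_exists {a b : unitInterval} {ω : ℤ → Site D} {n : ℤ}
    (h : ¬∃ m, LastRestart a ω m n) : restart a b ω n = (ω n).2.1 0 := by
  rw [exists_lastRestart_iff] at h
  rw [restart, dif_neg h]

lemma lastRestart_fullShift_iff {a : unitInterval} {ω : ℤ → Site D} {m n : ℤ} :
    LastRestart a (fullShift ω) m n ↔ LastRestart a ω (m + 1) (n + 1) := by
  unfold LastRestart fullShift
  refine and_congr (by omega) (and_congr_right fun _ => ⟨fun h i hi hi' => ?_, fun h i hi hi' => ?_⟩)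
  · simpa using h (i - 1) (by omega) (by omega)
  · exact h (i + 1) (by omega) (by omega)

lemma restart_fullShift (a b : unitInterval) (ω : ℤ → Site D) :
    restart a b (fullShift ω) = fullShift (restart a b ω) := by
  funext n
  by_cases h : ∃ m, LastRestart a (fullShift ω) m n
  · obtain ⟨m, hm⟩ := h
    rw [restart_of_lastRestart hm, show fullShift (restart a b ω) n = restart a b ω (n + 1) from rfl,
      restart_of_lastRestart (lastRestart_fullShift_iff.1 hm)]
    simp only [freshSeq, add_sub_add_right_eq_sub]
    rfl
  · rw [restart_of_not_exists h, show fullShift (restart a b ω) n = restart a b ω (n + 1) from rfl,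
      restart_of_not_exists]
    · rfl
    · rintro ⟨m, hm⟩
      exact h ⟨m - 1, lastRestart_fullShift_iff.2 (by rwa [sub_add_cancel])⟩

variable [MeasurableSpace D]

lemma measurableSet_clock_lt (a : unitInterval) : MeasurableSet {s : Site D | s.1 < a} :=
  measurableSet_lt measurable_fst measurable_const

lemma measurableSet_lastRestart (a : unitInterval) (m n : ℤ) :
    MeasurableSet {ω : ℤ → Site D | LastRestart a ω m n} := by
  have h : ∀ i : ℤ, MeasurableSet {ω : ℤ → Site D | (ω i).1 < a} := fun i =>
    (measurable_pi_apply i : Measurable fun ω : ℤ → Site D => ω i) (measurableSet_clock_lt a)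
  have e : {ω : ℤ → Site D | LastRestart a ω m n} = {_ω | m ≤ n} ∩ ({ω | (ω m).1 < a} ∩
      ⋂ i : ℤ, ⋂ _ : m < i, ⋂ _ : i ≤ n, {ω | (ω i).1 < a}ᶜ) := by
    ext ω
    simp [LastRestart]
  rw [e]
  exact (MeasurableSet.const _).inter ((h m).inter (MeasurableSet.iInter fun i =>
    MeasurableSet.iInter fun _ => MeasurableSet.iInter fun _ => (h i).compl))

lemma measurable_freshSeq (b : unitInterval) (m : ℤ) :
    Measurable fun s : Site D => freshSeq b s m := by
  refine measurable_pi_lambda _ fun i => ?_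
  refine Measurable.ite (measurableSet_clock_lt b) ?_ ?_
  · exact (measurable_pi_apply (i - m)).comp (measurable_snd.comp measurable_snd)
  · exact (measurable_pi_apply (i - m)).comp (measurable_fst.comp measurable_snd)

lemma measurable_restart [Countable D] [DiscreteMeasurableSpace D] (a b : unitInterval) :
    Measurable (restart a b : (ℤ → Site D) → ℤ → D) := by
  refine measurable_pi_lambda _ fun n => measurable_to_countable' fun d => ?_
  have e : (fun ω : ℤ → Site D => restart a b ω n) ⁻¹' {d} =
      (⋃ m, {ω | LastRestart a ω m n} ∩ {ω | freshSeq b (ω m) m n = d}) ∪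
        ((⋂ m, {ω | LastRestart a ω m n}ᶜ) ∩ {ω | (ω n).2.1 0 = d}) := by
    ext ω
    simp only [Set.mem_preimage, Set.mem_singleton_iff, Set.mem_union, Set.mem_iUnion,
      Set.mem_inter_iff, Set.mem_ofPred_eq, Set.mem_iInter, Set.mem_compl_iff]
    by_cases h : ∃ m, LastRestart a ω m n
    · obtain ⟨m, hm⟩ := h
      rw [restart_of_lastRestart hm]
      constructor
      · exact fun h => Or.inl ⟨m, hm, h⟩
      · rintro (⟨m', h1, h2⟩ | ⟨h1, h2⟩)
        · rwa [h1.unique hm] at h2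
        · exact absurd hm (h1 m)
    · rw [restart_of_not_exists h]
      push Not at h
      constructor
      · exact fun h' => Or.inr ⟨h, h'⟩
      · rintro (⟨m', h1, h2⟩ | ⟨h1, h2⟩)
        · exact absurd h1 (h m')
        · exact h2
  rw [e]
  refine (MeasurableSet.iUnion fun m => (measurableSet_lastRestart a m n).inter ?_).union
    ((MeasurableSet.iInter fun m => (measurableSet_lastRestart a m n).compl).inter ?_)
  · have : Measurable fun ω : ℤ → Site D => freshSeq b (ω m) m n :=
      (measurable_pi_apply n).comp ((measurable_freshSeq b m).comp (measurable_pi_apply m))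
    exact this (measurableSet_singleton d)
  · have : Measurable fun ω : ℤ → Site D => (ω n).2.1 0 :=
      (measurable_pi_apply 0).comp (measurable_fst.comp (measurable_snd.comp (measurable_pi_apply n)))
    exact this (measurableSet_singleton d)

variable (μ ν : Measure (ℤ → D))

/-- The distribution of the data at a single time. -/
noncomputable def siteMeasure : Measure (Site D) := (volume : Measure unitInterval).prod (μ.prod ν)

/-- The distribution of the data at all times, independent of each other. -/
noncomputable def sitesMeasure : Measure (ℤ → Site D) := Measure.infinitePi fun _ => siteMeasure μ ν

variable [IsProbabilityMeasure μ] [IsProbabilityMeasure ν]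

instance : IsProbabilityMeasure (siteMeasure μ ν) := by unfold siteMeasure; infer_instance

instance : IsProbabilityMeasure (sitesMeasure μ ν) := by unfold sitesMeasure; infer_instance

lemma siteMeasure_clock_lt (a : unitInterval) :
    siteMeasure μ ν {s | s.1 < a} = ENNReal.ofReal a := by
  have e : {s : Site D | s.1 < a} = Set.Iio a ×ˢ Set.univ := by ext s; simp
  rw [e, siteMeasure, Measure.prod_prod, measure_univ, mul_one, unitInterval.volume_Iio]

lemma map_eval_sitesMeasure (i : ℤ) :
    (sitesMeasure μ ν).map (fun ω => ω i) = siteMeasure μ ν :=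
  (measurePreserving_eval_infinitePi (fun _ : ℤ => siteMeasure μ ν) i).map_eq

lemma sitesMeasure_clock_lt (a : unitInterval) (i : ℤ) :
    sitesMeasure μ ν {ω | (ω i).1 < a} = ENNReal.ofReal a := by
  rw [← siteMeasure_clock_lt μ ν a, ← map_eval_sitesMeasure μ ν i,
    Measure.map_apply (measurable_pi_apply i) (measurableSet_clock_lt a)]
  rfl

/-- Off this null set, comparing a clock with a threshold near `a` gives a locally constant answer;
continuity in the parameters rests on this. -/
lemma ae_clock_ne (a : unitInterval) : ∀ᵐ ω ∂sitesMeasure μ ν, ∀ i, (ω i).1 ≠ a := by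
  rw [ae_all_iff]
  intro i
  have h : ∀ᵐ s ∂siteMeasure μ ν, s.1 ≠ a := by
    have h0 : ∀ᵐ v ∂(volume : Measure unitInterval), v ≠ a := by
      rw [ae_iff]; simp
    exact Measure.quasiMeasurePreserving_fst.ae h0
  rw [← map_eval_sitesMeasure μ ν i] at h
  exact ae_of_ae_map (measurable_pi_apply i).aemeasurable h

lemma ae_exists_lastRestart {a : unitInterval} (ha : 0 < a) :
    ∀ᵐ ω ∂sitesMeasure μ ν, ∀ n, ∃ m, LastRestart a ω m n := by
  rw [ae_all_iff]
  intro n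
  simp_rw [exists_lastRestart_iff]
  rw [ae_iff]
  set q := siteMeasure μ ν {s | s.1 < a}ᶜ with hq
  have hq1 : q < 1 := by
    rw [hq, prob_compl_eq_one_sub (measurableSet_clock_lt a), siteMeasure_clock_lt]
    exact ENNReal.sub_lt_self ENNReal.one_ne_top one_ne_zero
      (by simpa [ENNReal.ofReal_eq_zero] using ha)
  have hle : ∀ K : ℕ, sitesMeasure μ ν {ω | ¬∃ k : ℕ, (ω (n - k)).1 < a} ≤ q ^ K := by
    intro K
    have h1 : {ω : ℤ → Site D | ¬∃ k : ℕ, (ω (n - k)).1 < a} ⊆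
        ((Finset.Ioc (n - K) n : Finset ℤ) : Set ℤ).pi fun _ => {s | s.1 < a}ᶜ := by
      intro ω hω i hi hlt
      simp only [Finset.coe_Ioc, Set.mem_Ioc] at hi
      refine hω ⟨(n - i).toNat, ?_⟩
      rw [show n - ((n - i).toNat : ℤ) = i by omega]
      exact hlt
    refine (measure_mono h1).trans ?_
    rw [sitesMeasure, Measure.infinitePi_pi _ fun i _ => (measurableSet_clock_lt a).compl]
    simp [hq]
  exact le_antisymm (ge_of_tendsto' (ENNReal.tendsto_pow_atTop_nhds_zero_of_lt_one hq1) hle) bot_le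

/-- Applied with `k` a restart time and `B` the event that no later clock in the window triggers
another restart. -/
lemma setIntegral_eval_of_notMem {T : Finset ℤ} {k : ℤ} (hk : k ∉ T) {B : Set (T → Site D)}
    (hB : MeasurableSet B) {φ : Site D → ℝ} (hφ : Measurable φ) :
    ∫ ω in T.restrict ⁻¹' B, φ (ω k) ∂sitesMeasure μ ν =
      (sitesMeasure μ ν).real (T.restrict ⁻¹' B) * ∫ s, φ s ∂siteMeasure μ ν := by
  have hB' : MeasurableSet ((T.restrict : (ℤ → Site D) → _) ⁻¹' B) :=
    (Finset.measurable_restrict T) hB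
  have hind := ProbabilityTheory.iIndepFun_infinitePi (P := fun _ : ℤ => siteMeasure μ ν)
    (X := fun _ x => x) (fun _ => measurable_id)
  have h2 := hind.indepFun_finset {k} T (by simpa using hk) fun i => measurable_pi_apply i
  have hψ : Measurable (B.indicator fun _ => (1 : ℝ)) := measurable_const.indicator hB
  have hφ' : Measurable fun z : ({k} : Finset ℤ) → Site D =>
      φ (z ⟨k, Finset.mem_singleton_self k⟩) := hφ.comp (measurable_pi_apply _)
  have h3 := (h2.comp hφ' hψ).integral_fun_mul_eq_mul_integral
    (hφ'.comp (measurable_pi_lambda _ fun i => measurable_pi_apply _)).aestronglyMeasurable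
    (hψ.comp (measurable_pi_lambda _ fun i => measurable_pi_apply _)).aestronglyMeasurable
  simp only [Function.comp_apply] at h3
  have e1 : ∫ s, φ s ∂siteMeasure μ ν = ∫ ω, φ (ω k) ∂sitesMeasure μ ν := by
    rw [← map_eval_sitesMeasure μ ν k]
    exact integral_map (measurable_pi_apply k).aemeasurable hφ.aestronglyMeasurable
  have e2 : (sitesMeasure μ ν).real (T.restrict ⁻¹' B) =
      ∫ ω, B.indicator (fun _ => (1 : ℝ)) (fun i : T => ω i) ∂sitesMeasure μ ν := by
    rw [← integral_indicator_one hB']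
    rfl
  rw [e1, e2, ← integral_indicator hB', mul_comm]
  refine Eq.trans ?_ h3
  refine integral_congr_ae (Eventually.of_forall fun ω => ?_)
  by_cases hω : T.restrict ω ∈ B
  · have hω' : (fun i : T => ω i) ∈ B := hω
    simp [Set.indicator, hω, hω']
  · have hω' : (fun i : T => ω i) ∉ B := hω
    simp [Set.indicator, hω, hω']

end Restart

/-! ### Window statistics of the restarted sequence -/

section RestartIntegral

variable {D : Type*} [MeasurableSpace D] {μ ν : Measure (ℤ → D)}

lemma integral_comp_translate (hμ : MeasurePreserving fullShift μ μ) {f : (ℤ → D) → ℝ}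
    (hf : Measurable f) (m : ℤ) : ∫ y, f (fun i => y (i - m)) ∂μ = ∫ y, f y ∂μ := by
  have key : ∀ {e : (ℤ → D) → ℤ → D}, MeasurePreserving e μ μ →
      ∫ y, f (e y) ∂μ = ∫ y, f y ∂μ := by
    intro e he
    conv_rhs => rw [← he.map_eq]
    exact (integral_map he.measurable.aemeasurable hf.aestronglyMeasurable).symm
  have hsymm : MeasurePreserving (fullShiftEquiv D).symm μ μ :=
    MeasurePreserving.symm (fullShiftEquiv D) hμ
  rcases le_total 0 m with h | h
  · lift m to ℕ using h
    rw [← key (hsymm.iterate m)]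
    congr 1; funext y; congr 1; funext i
    rw [fullShiftEquiv_symm_iterate]
  · obtain ⟨n, rfl⟩ : ∃ n : ℕ, m = -n := ⟨(-m).toNat, by omega⟩
    rw [← key (hμ.iterate n)]
    congr 1; funext y; congr 1; funext i
    rw [fullShift_iterate, sub_neg_eq_add]

variable [IsProbabilityMeasure μ] [IsProbabilityMeasure ν]

lemma volume_real_Iio (a : unitInterval) : (volume : Measure unitInterval).real (Set.Iio a) = a := by
  rw [measureReal_def, unitInterval.volume_Iio, ENNReal.toReal_ofReal a.2.1]

/-- Clocks in `[0, b)` select `ν` and clocks in `[b, a)` select `μ`; stationarity removes the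
translation by `m`. For `b = t * a` the result is `a` times the mixture. -/
lemma setIntegral_freshSeq (hμ : MeasurePreserving fullShift μ μ)
    (hν : MeasurePreserving fullShift ν ν) {a b : unitInterval} (hba : b ≤ a) {f : (ℤ → D) → ℝ}
    (hf : Measurable f) {C : ℝ} (hC : ∀ y, |f y| ≤ C) (m : ℤ) :
    ∫ s in {s | s.1 < a}, f (freshSeq b s m) ∂siteMeasure μ ν =
      (a - b) * ∫ y, f y ∂μ + b * ∫ y, f y ∂ν := by
  have hint : Integrable (fun s => f (freshSeq b s m)) (siteMeasure μ ν) :=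
    Integrable.of_bound (hf.comp (measurable_freshSeq b m)).aestronglyMeasurable C
      (Eventually.of_forall fun s => hC _)
  have hsplit : {s : Site D | s.1 < a} = {s | s.1 < b} ∪ {s | s.1 ∈ Set.Ico b a} := by
    ext s
    simp only [Set.mem_ofPred_eq, Set.mem_union, Set.mem_Ico]
    constructor
    · intro h
      rcases lt_or_ge s.1 b with h' | h'
      · exact Or.inl h'
      · exact Or.inr ⟨h', h⟩
    · rintro (h | h)
      · exact h.trans_le hba
      · exact h.2
  have hm2 : MeasurableSet {s : Site D | s.1 ∈ Set.Ico b a} := measurable_fst measurableSet_Ico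
  have hdisj : Disjoint {s : Site D | s.1 < b} {s | s.1 ∈ Set.Ico b a} := by
    rw [Set.disjoint_left]
    intro s h1 h2
    exact absurd h1 (not_lt.2 h2.1)
  have hIco : (volume : Measure unitInterval).real (Set.Ico b a) = a - b := by
    have : Set.Ico b a = Set.Iio a \ Set.Iio b := by ext; simp
    rw [this, measureReal_sdiff (Set.Iio_subset_Iio hba) measurableSet_Iio, volume_real_Iio,
      volume_real_Iio]
  rw [hsplit, setIntegral_union hdisj hm2 hint.integrableOn hint.integrableOn, add_comm]
  congr 1
  · have h1 : ∫ s in {s : Site D | s.1 ∈ Set.Ico b a}, f (freshSeq b s m) ∂siteMeasure μ ν =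
        ∫ s : Site D, (Set.Ico b a).indicator (fun _ => (1 : ℝ)) s.1 *
          f (fun i => s.2.1 (i - m)) ∂siteMeasure μ ν := by
      rw [← integral_indicator hm2]
      congr 1; funext s
      by_cases hs : s.1 ∈ Set.Ico b a
      · have hs' : s ∈ {s : Site D | s.1 ∈ Set.Ico b a} := hs
        rw [Set.indicator_of_mem hs', Set.indicator_of_mem hs, one_mul]
        congr 1; funext i
        rw [freshSeq, if_neg (not_lt.2 hs.1)]
      · have hs' : s ∉ {s : Site D | s.1 ∈ Set.Ico b a} := hs
        rw [Set.indicator_of_notMem hs', Set.indicator_of_notMem hs, zero_mul]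
    rw [h1, siteMeasure, integral_prod_mul (fun v => (Set.Ico b a).indicator (fun _ => (1 : ℝ)) v)
      (fun p : (ℤ → D) × (ℤ → D) => f fun i => p.1 (i - m)),
      integral_indicator_const _ measurableSet_Ico, hIco, smul_eq_mul, mul_one,
      ← integral_comp_translate hμ hf m]
    congr 1
    have h2 := integral_prod_mul (μ := μ) (ν := ν) (fun y : ℤ → D => f fun i => y (i - m))
      (fun _ => (1 : ℝ))
    simpa using h2
  · have h1 : ∫ s in {s : Site D | s.1 < b}, f (freshSeq b s m) ∂siteMeasure μ ν =
        ∫ s : Site D, (Set.Iio b).indicator (fun _ => (1 : ℝ)) s.1 *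
          f (fun i => s.2.2 (i - m)) ∂siteMeasure μ ν := by
      rw [← integral_indicator (measurableSet_clock_lt b)]
      congr 1; funext s
      by_cases hs : s.1 < b
      · have hs' : s ∈ {s : Site D | s.1 < b} := hs
        have hs'' : s.1 ∈ Set.Iio b := hs
        rw [Set.indicator_of_mem hs', Set.indicator_of_mem hs'', one_mul]
        congr 1; funext i
        rw [freshSeq, if_pos hs]
      · have hs' : s ∉ {s : Site D | s.1 < b} := hs
        have hs'' : s.1 ∉ Set.Iio b := hs
        rw [Set.indicator_of_notMem hs', Set.indicator_of_notMem hs'', zero_mul]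
    rw [h1, siteMeasure, integral_prod_mul (fun v => (Set.Iio b).indicator (fun _ => (1 : ℝ)) v)
      (fun p : (ℤ → D) × (ℤ → D) => f fun i => p.2 (i - m)),
      integral_indicator_const _ measurableSet_Iio, volume_real_Iio, smul_eq_mul, mul_one,
      ← integral_comp_translate hν hf m]
    congr 1
    have h2 := integral_prod_mul (μ := μ) (ν := ν) (fun _ => (1 : ℝ))
      (fun y : ℤ → D => f fun i => y (i - m))
    simpa using h2

/-- The integral of `f` against the convex combination of two measures. -/
noncomputable def mixedIntegral (μ ν : Measure (ℤ → D)) (t : unitInterval) (f : (ℤ → D) → ℝ) : ℝ :=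
  (1 - t) * ∫ y, f y ∂μ + t * ∫ y, f y ∂ν

/-- No restart takes place at the times in `(p, q]`. -/
def noRestart (D : Type*) (a : unitInterval) (p q : ℤ) : Set (ℤ → Site D) :=
  {ω | ∀ i, p < i → i ≤ q → ¬(ω i).1 < a}

lemma measurableSet_noRestart (a : unitInterval) (p q : ℤ) :
    MeasurableSet (noRestart D a p q) := by
  have h : ∀ i : ℤ, MeasurableSet {ω : ℤ → Site D | (ω i).1 < a} := fun i =>
    (measurable_pi_apply i : Measurable fun ω : ℤ → Site D => ω i) (measurableSet_clock_lt a)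
  have e : noRestart D a p q = ⋂ i : ℤ, ⋂ _ : p < i, ⋂ _ : i ≤ q, {ω | (ω i).1 < a}ᶜ := by
    ext ω
    simp [noRestart]
  rw [e]
  exact MeasurableSet.iInter fun i =>
    MeasurableSet.iInter fun _ => MeasurableSet.iInter fun _ => (h i).compl

/-- With the last restart at `m ≤ p`, the window `[p, q]` is read off one fresh sequence. That
sequence is determined by the data at `m`, which are independent of the clocks in `(m, q]`. -/
lemma setIntegral_restart_of_lastRestart (hμ : MeasurePreserving fullShift μ μ)
    (hν : MeasurePreserving fullShift ν ν) (a t : unitInterval) {f : (ℤ → D) → ℝ}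
    (hf : Measurable f) {C : ℝ} (hC : ∀ y, |f y| ≤ C) {m p q : ℤ} (hmp : m ≤ p) (hpq : p ≤ q)
    (hdep : ∀ x y : ℤ → D, (∀ i, p ≤ i → i ≤ q → x i = y i) → f x = f y) :
    ∫ ω in {ω | LastRestart a ω m q}, f (restart a (t * a) ω) ∂sitesMeasure μ ν =
      (sitesMeasure μ ν).real {ω | LastRestart a ω m q} * mixedIntegral μ ν t f := by
  let T : Finset ℤ := Finset.Ioc m q
  let B : Set (T → Site D) := {z | ∀ i, ¬(z i).1 < a}
  have hB : MeasurableSet B := by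
    have e : B = ⋂ i, (fun z : T → Site D => z i) ⁻¹' {s | s.1 < a}ᶜ := by ext; simp [B]
    rw [e]
    exact MeasurableSet.iInter fun i => measurable_pi_apply i (measurableSet_clock_lt a).compl
  have hT : m ∉ T := by simp [T]
  have hclock : MeasurableSet {ω : ℤ → Site D | (ω m).1 < a} :=
    (measurable_pi_apply m : Measurable fun ω : ℤ → Site D => ω m) (measurableSet_clock_lt a)
  have hset : {ω : ℤ → Site D | LastRestart a ω m q} = T.restrict ⁻¹' B ∩ {ω | (ω m).1 < a} := by
    ext ω
    simp only [LastRestart, Set.mem_ofPred_eq, Set.mem_inter_iff, Set.mem_preimage, B,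
      Finset.restrict, Subtype.forall, T, Finset.mem_Ioc]
    constructor
    · rintro ⟨-, h2, h3⟩
      exact ⟨fun i hi => h3 i hi.1 hi.2, h2⟩
    · rintro ⟨h1, h2⟩
      exact ⟨hmp.trans hpq, h2, fun i hi hi' => h1 i ⟨hi, hi'⟩⟩
  have hta : t * a ≤ a := unitInterval.mul_le_right
  have general : ∀ {h : (ℤ → D) → ℝ}, Measurable h → (∀ y, |h y| ≤ C) →
      ∫ ω in {ω | LastRestart a ω m q}, h (freshSeq (t * a) (ω m) m) ∂sitesMeasure μ ν =
        (sitesMeasure μ ν).real (T.restrict ⁻¹' B) * (a * mixedIntegral μ ν t h) := by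
    intro h hh hhC
    have hφ : Measurable ({s : Site D | s.1 < a}.indicator fun s => h (freshSeq (t * a) s m)) :=
      (hh.comp (measurable_freshSeq _ m)).indicator (measurableSet_clock_lt a)
    have h1 := setIntegral_eval_of_notMem (μ := μ) (ν := ν) hT hB hφ
    rw [integral_indicator (measurableSet_clock_lt a),
      setIntegral_freshSeq hμ hν hta hh hhC m] at h1
    rw [hset, ← setIntegral_indicator hclock]
    refine Eq.trans ?_ (h1.trans ?_)
    · rfl
    · rw [mixedIntegral]
      push_cast
      ring
  have hone : (sitesMeasure μ ν).real {ω | LastRestart a ω m q} =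
      (sitesMeasure μ ν).real (T.restrict ⁻¹' B) * a := by
    have h1 := setIntegral_eval_of_notMem (μ := μ) (ν := ν) hT hB
      (φ := {s : Site D | s.1 < a}.indicator fun _ => 1)
      (measurable_const.indicator (measurableSet_clock_lt a))
    rw [integral_indicator_const _ (measurableSet_clock_lt a), measureReal_def (siteMeasure μ ν),
      siteMeasure_clock_lt, ENNReal.toReal_ofReal a.2.1, smul_eq_mul, mul_one] at h1
    rw [← h1, hset]
    have h2 := setIntegral_indicator (μ := sitesMeasure μ ν) (s := T.restrict ⁻¹' B) hclock
      (f := fun _ => (1 : ℝ))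
    refine Eq.trans ?_ (h2.symm.trans rfl)
    simp
  rw [hone, mul_assoc, ← general hf hC]
  refine setIntegral_congr_fun (measurableSet_lastRestart a m q) fun ω hω => ?_
  refine hdep _ _ fun i hi hi' => restart_of_lastRestart ⟨hmp.trans hi, hω.2.1, fun j hj hj' => ?_⟩
  exact hω.2.2 j hj (hj'.trans hi')

variable [Countable D] [DiscreteMeasurableSpace D]

/-- Without a restart inside a window, the restarted sequence has the statistics of the mixture of
the two sources there. -/
lemma setIntegral_restart_noRestart (hμ : MeasurePreserving fullShift μ μ)
    (hν : MeasurePreserving fullShift ν ν) {a : unitInterval} (ha : 0 < a) (t : unitInterval)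
    {f : (ℤ → D) → ℝ} (hf : Measurable f) {C : ℝ} (hC : ∀ y, |f y| ≤ C) {p q : ℤ} (hpq : p ≤ q)
    (hdep : ∀ x y : ℤ → D, (∀ i, p ≤ i → i ≤ q → x i = y i) → f x = f y) :
    ∫ ω in noRestart D a p q, f (restart a (t * a) ω) ∂sitesMeasure μ ν =
      (sitesMeasure μ ν).real (noRestart D a p q) * mixedIntegral μ ν t f := by
  -- Partition by the time of the last restart. A restart at `p` itself is harmless, hence `k = 0`
  -- is allowed.
  let R : ℕ → Set (ℤ → Site D) := fun k => {ω | LastRestart a ω (p - k) q}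
  have hR : ∀ k, MeasurableSet (R k) := fun k => measurableSet_lastRestart a _ q
  have hdisj : Pairwise (Function.onFun Disjoint R) := by
    intro k l hkl
    rw [Function.onFun, Set.disjoint_left]
    intro ω h1 h2
    have := LastRestart.unique h1 h2
    omega
  have hU : noRestart D a p q =ᵐ[sitesMeasure μ ν] ⋃ k, R k := by
    filter_upwards [ae_exists_lastRestart μ ν ha] with ω hω
    apply propext
    change ω ∈ noRestart D a p q ↔ ω ∈ ⋃ k, R k
    rw [Set.mem_iUnion]
    constructor
    · intro h
      obtain ⟨m, h1, h2, h3⟩ := hω q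
      have hmp : m ≤ p := by
        by_contra hc
        exact h m (by omega) h1 h2
      refine ⟨(p - m).toNat, ?_⟩
      change LastRestart a ω _ q
      rw [show p - ((p - m).toNat : ℤ) = m by omega]
      exact ⟨h1, h2, h3⟩
    · rintro ⟨k, -, h2, h3⟩ i hi hi'
      exact h3 i (by omega) hi'
  have hint : ∀ {h : (ℤ → D) → ℝ}, Measurable h → (∀ y, |h y| ≤ C) →
      Integrable (fun ω => h (restart a (t * a) ω)) (sitesMeasure μ ν) := fun hh hhC =>
    Integrable.of_bound (hh.comp (measurable_restart _ _)).aestronglyMeasurable C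
      (Eventually.of_forall fun ω => hhC _)
  rw [setIntegral_congr_set hU, integral_iUnion hR hdisj (hint hf hC).integrableOn,
    measureReal_congr hU]
  have h1 : ∀ k, ∫ ω in R k, f (restart a (t * a) ω) ∂sitesMeasure μ ν =
      (sitesMeasure μ ν).real (R k) * mixedIntegral μ ν t f := fun k =>
    setIntegral_restart_of_lastRestart hμ hν a t hf hC (by omega) hpq hdep
  simp_rw [h1]
  rw [tsum_mul_right]
  congr 1
  rw [measureReal_def, measure_iUnion hdisj hR, ENNReal.tsum_toReal_eq fun k => measure_ne_top _ _]
  rfl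

end RestartIntegral

/-! ### Comparison with the mixture, uniformly in the measures -/

section RestartPath

/-- The sequence continued constantly outside the window `[-n, n]`. -/
def clampSeq {D : Type*} (n : ℕ) (x : ℤ → D) (i : ℤ) : D := x (max (-n) (min i n))

section Measurable

variable {D : Type*} [MeasurableSpace D]

lemma measurable_clampSeq (n : ℕ) : Measurable (clampSeq n : (ℤ → D) → ℤ → D) :=
  measurable_pi_lambda _ fun _ => measurable_pi_apply _

lemma abs_mixedIntegral_le {μ ν : Measure (ℤ → D)} [IsProbabilityMeasure μ] [IsProbabilityMeasure ν]
    (t : unitInterval) {f : (ℤ → D) → ℝ} {C : ℝ} (hC : ∀ y, |f y| ≤ C) :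
    |mixedIntegral μ ν t f| ≤ C := by
  have h : ∀ κ : Measure (ℤ → D), IsProbabilityMeasure κ → |∫ y, f y ∂κ| ≤ C := fun κ _ => by
    simpa using norm_integral_le_of_norm_le_const (μ := κ) (f := f) (Eventually.of_forall hC)
  have hμ := abs_le.1 (h μ inferInstance)
  have hν := abs_le.1 (h ν inferInstance)
  have h0 := t.2.1
  have h1 := t.2.2
  rw [mixedIntegral, abs_le]
  constructor <;> nlinarith

lemma mixedIntegral_sub {μ ν : Measure (ℤ → D)} {f g : (ℤ → D) → ℝ} (t : unitInterval)
    (hfμ : Integrable f μ) (hgμ : Integrable g μ) (hfν : Integrable f ν) (hgν : Integrable g ν) :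
    mixedIntegral μ ν t f - mixedIntegral μ ν t g = mixedIntegral μ ν t fun y => f y - g y := by
  rw [mixedIntegral, mixedIntegral, mixedIntegral, integral_sub hfμ hgμ, integral_sub hfν hgν]
  ring

end Measurable

variable {D : Type*} [TopologicalSpace D] [Finite D]

/-- By compactness of the full shift, locally uniform convergence is uniform: `f` is uniformly close
to a function of finitely many coordinates. -/
lemma exists_abs_sub_clampSeq_lt {f : (ℤ → D) → ℝ} (hf : Continuous f) {ε : ℝ} (hε : 0 < ε) :
    ∃ n : ℕ, ∀ x, |f x - f (clampSeq n x)| < ε := by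
  have h : TendstoLocallyUniformly (fun (n : ℕ) x => f (clampSeq n x)) f atTop := by
    rw [tendstoLocallyUniformly_iff_forall_tendsto]
    intro x
    have h1 : Tendsto (fun p : ℕ × (ℤ → D) => clampSeq p.1 p.2) (atTop ×ˢ nhds x) (nhds x) := by
      rw [tendsto_pi_nhds]
      intro i
      have h2 : Tendsto (fun p : ℕ × (ℤ → D) => p.2 i) (atTop ×ˢ nhds x) (nhds (x i)) :=
        ((continuous_apply i).tendsto x).comp tendsto_snd
      refine h2.congr' ?_
      filter_upwards [tendsto_fst.eventually (eventually_ge_atTop i.natAbs)] with p hp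
      have h3 : max (-(p.1 : ℤ)) (min i p.1) = i := by omega
      simp only [clampSeq, h3]
    have h3 : Tendsto (fun p : ℕ × (ℤ → D) => (f p.2, f (clampSeq p.1 p.2))) (atTop ×ˢ nhds x)
        (nhds (f x) ×ˢ nhds (f x)) :=
      ((hf.tendsto x).comp tendsto_snd).prodMk ((hf.tendsto x).comp h1)
    exact h3.mono_right (by rw [← nhds_prod_eq]; exact nhds_le_uniformity (f x))
  rw [tendstoLocallyUniformly_iff_tendstoUniformly_of_compactSpace] at h
  obtain ⟨n, hn⟩ := ((Metric.tendstoUniformly_iff.1 h) ε hε).exists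
  exact ⟨n, fun x => by simpa [Real.dist_eq] using hn x⟩

variable [DiscreteTopology D] [MeasurableSpace D] [BorelSpace D]

/-- A window without a restart has exactly the statistics of the mixture, and a restart inside it is
unlikely. It matters that `L` depends on `f`, `C` and `ε` only, not on the measures. -/
lemma abs_integral_restart_sub_mixedIntegral_le {f : (ℤ → D) → ℝ} (hf : Continuous f) {C : ℝ}
    (hC0 : 0 ≤ C) (hC : ∀ y, |f y| ≤ C) {ε : ℝ} (hε : 0 < ε) :
    ∃ L : ℝ, 0 ≤ L ∧ ∀ (μ ν : Measure (ℤ → D)) [IsProbabilityMeasure μ] [IsProbabilityMeasure ν],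
      MeasurePreserving fullShift μ μ → MeasurePreserving fullShift ν ν →
      ∀ a t : unitInterval, 0 < a →
        |∫ ω, f (restart a (t * a) ω) ∂sitesMeasure μ ν - mixedIntegral μ ν t f| ≤ ε + L * a := by
  obtain ⟨n, hn⟩ := exists_abs_sub_clampSeq_lt hf (half_pos hε)
  -- A restart among the `2 * n` times in `(-n, n]` has probability at most `2 * n * a`, and on that
  -- event the two integrands differ by at most `2 * C`.
  refine ⟨2 * C * (2 * n), by positivity, ?_⟩
  intro μ ν _ _ hμ hν a t ha
  set P := sitesMeasure μ ν with hP
  set f' : (ℤ → D) → ℝ := fun x => f (clampSeq n x) with hf'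
  have hfm : Measurable f := hf.measurable
  have hfm' : Measurable f' := hfm.comp (measurable_clampSeq n)
  have hC' : ∀ y, |f' y| ≤ C := fun y => hC _
  have hi : ∀ {h : (ℤ → D) → ℝ}, Measurable h → (∀ y, |h y| ≤ C) →
      Integrable (fun ω => h (restart a (t * a) ω)) P := fun hh hhC =>
    Integrable.of_bound (hh.comp (measurable_restart _ _)).aestronglyMeasurable C
      (Eventually.of_forall fun ω => hhC _)
  have hi' : ∀ (κ : Measure (ℤ → D)) [IsProbabilityMeasure κ] {h : (ℤ → D) → ℝ}, Measurable h →
      (∀ y, |h y| ≤ C) → Integrable h κ := fun κ _ _ hh hhC =>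
    Integrable.of_bound hh.aestronglyMeasurable C (Eventually.of_forall fun ω => hhC _)
  have h1 : |∫ ω, f (restart a (t * a) ω) ∂P - ∫ ω, f' (restart a (t * a) ω) ∂P| ≤ ε / 2 := by
    rw [← integral_sub (hi hfm hC) (hi hfm' hC')]
    simpa using norm_integral_le_of_norm_le_const (μ := P)
      (f := fun ω => f (restart a (t * a) ω) - f' (restart a (t * a) ω))
      (Eventually.of_forall fun ω => (hn _).le)
  have h2 : |mixedIntegral μ ν t f' - mixedIntegral μ ν t f| ≤ ε / 2 := by
    rw [abs_sub_comm, mixedIntegral_sub t (hi' μ hfm hC) (hi' μ hfm' hC') (hi' ν hfm hC)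
      (hi' ν hfm' hC')]
    exact abs_mixedIntegral_le t fun y => (hn y).le
  set A := noRestart D a (-n) n with hA
  have hAm : MeasurableSet A := measurableSet_noRestart a _ _
  have h3 : ∫ ω in A, f' (restart a (t * a) ω) ∂P = P.real A * mixedIntegral μ ν t f' :=
    setIntegral_restart_noRestart hμ hν ha t hfm' hC' (by omega) fun x y hxy => by
      simp only [hf']
      congr 1
      funext i
      exact hxy _ (by omega) (by omega)
  have hAc : P.real Aᶜ ≤ 2 * n * a := by
    have hsub : Aᶜ ⊆ ⋃ i ∈ Finset.Ioc (-n : ℤ) n, {ω | (ω i).1 < a} := by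
      intro ω hω
      simp only [hA, noRestart, Set.mem_compl_iff, Set.mem_ofPred_eq, not_forall, not_not] at hω
      obtain ⟨i, h1, h2, h3⟩ := hω
      simp only [Set.mem_iUnion, Finset.mem_Ioc]
      exact ⟨i, ⟨h1, h2⟩, h3⟩
    refine (measureReal_mono hsub (measure_ne_top _ _)).trans ((measureReal_biUnion_finset_le _ _).trans ?_)
    have h4 : ∀ i : ℤ, P.real {ω | (ω i).1 < a} = a := fun i => by
      rw [measureReal_def, sitesMeasure_clock_lt, ENNReal.toReal_ofReal a.2.1]
    simp only [h4, Finset.sum_const, Int.card_Ioc, nsmul_eq_mul]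
    apply le_of_eq
    congr 1
    have : ((n : ℤ) - -n).toNat = 2 * n := by omega
    rw [this]; push_cast; ring
  have h4 : |∫ ω in Aᶜ, f' (restart a (t * a) ω) ∂P| ≤ C * P.real Aᶜ := by
    have := norm_setIntegral_le_of_norm_le_const (μ := P) (s := Aᶜ) (C := C)
      (f := fun ω => f' (restart a (t * a) ω)) (measure_lt_top _ _) fun ω _ => hC' _
    simpa using this
  have h5 := integral_add_compl hAm (hi hfm' hC')
  have h6 := abs_mixedIntegral_le (μ := μ) (ν := ν) t hC'
  have h7 : P.real A = 1 - P.real Aᶜ := by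
    rw [probReal_compl_eq_one_sub hAm]; ring
  rw [h3, h7] at h5
  have h8 : |P.real Aᶜ * mixedIntegral μ ν t f'| ≤ P.real Aᶜ * C := by
    rw [abs_mul, abs_of_nonneg measureReal_nonneg]
    exact mul_le_mul_of_nonneg_left h6 measureReal_nonneg
  have h9 : C * P.real Aᶜ ≤ C * (2 * n * a) := mul_le_mul_of_nonneg_left hAc hC0
  rw [abs_le] at h1 h2 h4 h8 ⊢
  constructor <;> nlinarith

end RestartPath

/-! ### Continuity of the restart path -/

section RestartPath

section Pointwise

variable {D : Type*} [TopologicalSpace D] [DiscreteTopology D]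

lemma eventually_lt_iff_of_tendsto {ι : Type*} {l : Filter ι} {a : ι → unitInterval}
    {a₀ v : unitInterval} (ha : Tendsto a l (nhds a₀)) (hv : v ≠ a₀) :
    ∀ᶠ t in l, v < a t ↔ v < a₀ := by
  rcases lt_or_gt_of_ne hv with h | h
  · filter_upwards [ha.eventually (eventually_gt_nhds h)] with t ht
    exact ⟨fun _ => h, fun _ => ht⟩
  · filter_upwards [ha.eventually (eventually_lt_nhds h)] with t ht
    exact ⟨fun h' => absurd h' (not_lt.2 ht.le), fun h' => absurd h' (not_lt.2 h.le)⟩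

/-- A coordinate depends on finitely many clock comparisons, back to its last restart, and each
stabilises when no clock equals a threshold. -/
lemma tendsto_restart {ι : Type*} {l : Filter ι} {a b : ι → unitInterval} {a₀ b₀ : unitInterval}
    (ha : Tendsto a l (nhds a₀)) (hb : Tendsto b l (nhds b₀)) {ω : ℤ → Site D}
    (hωa : ∀ i, (ω i).1 ≠ a₀) (hωb : ∀ i, (ω i).1 ≠ b₀) (hω : ∀ n, ∃ m, LastRestart a₀ ω m n) :
    Tendsto (fun t => restart (a t) (b t) ω) l (nhds (restart a₀ b₀ ω)) := by
  rw [tendsto_pi_nhds]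
  intro n
  rw [nhds_discrete D, tendsto_pure]
  obtain ⟨m, hm⟩ := hω n
  have h1 : ∀ᶠ t in l, ∀ i ∈ Finset.Icc m n, (ω i).1 < a t ↔ (ω i).1 < a₀ :=
    (Finset.Icc m n).eventually_all.2 fun i _ => eventually_lt_iff_of_tendsto ha (hωa i)
  filter_upwards [h1, eventually_lt_iff_of_tendsto hb (hωb m)] with t ht1 ht2
  have hmt : LastRestart (a t) ω m n := by
    refine ⟨hm.1, (ht1 m (by simpa using hm.1)).2 hm.2.1, fun i hi hi' => ?_⟩
    rw [ht1 i (Finset.mem_Icc.2 ⟨hi.le, hi'⟩)]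
    exact hm.2.2 i hi hi'
  rw [restart_of_lastRestart hm, restart_of_lastRestart hmt]
  simp only [freshSeq, ht2]

end Pointwise

variable {D : Type*} [TopologicalSpace D] [DiscreteTopology D] [Finite D] [MeasurableSpace D]
  [BorelSpace D]

/-- The law of the restarted sequence. -/
noncomputable def restartLaw (μ ν : ProbabilityMeasure (ℤ → D)) (a b : unitInterval) :
    ProbabilityMeasure (ℤ → D) :=
  ⟨(sitesMeasure (μ : Measure (ℤ → D)) ν).map (restart a b),
    Measure.isProbabilityMeasure_map (measurable_restart a b).aemeasurable⟩

lemma integral_restartLaw (μ ν : ProbabilityMeasure (ℤ → D)) (a b : unitInterval) {f : (ℤ → D) → ℝ}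
    (hf : Measurable f) : ∫ y, f y ∂(restartLaw μ ν a b : Measure (ℤ → D)) =
      ∫ ω, f (restart a b ω) ∂sitesMeasure (μ : Measure (ℤ → D)) ν :=
  integral_map (measurable_restart a b).aemeasurable hf.aestronglyMeasurable

lemma ergodic_restartLaw (μ ν : ProbabilityMeasure (ℤ → D)) (a b : unitInterval) :
    Ergodic fullShift (restartLaw μ ν a b : Measure (ℤ → D)) := by
  have h : MeasurePreserving (restart a b) (sitesMeasure (μ : Measure (ℤ → D)) ν)
      (restartLaw μ ν a b : Measure (ℤ → D)) := ⟨measurable_restart a b, rfl⟩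
  refine h.ergodic_of_ergodic_semiconj (f := fullShift) ?_ measurable_fullShift ?_
  · exact ergodic_fullShift_infinitePi _
  · exact fun ω => restart_fullShift a b ω

/-- The restart rate along the path: positive in the interior and zero at the end points. -/
noncomputable def restartRate (c t : unitInterval) : unitInterval := c * (t * unitInterval.symm t)

lemma restartRate_pos {c t : unitInterval} (hc : 0 < c) (h0 : t ≠ 0) (h1 : t ≠ 1) :
    0 < restartRate c t := by
  have ht : (0 : ℝ) < t := (unitInterval.pos_iff_ne_zero.2 h0)
  have ht' : (t : ℝ) < 1 := (unitInterval.lt_one_iff_ne_one.2 h1)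
  have hc' : (0 : ℝ) < c := hc
  rw [← Subtype.coe_lt_coe]
  simp only [restartRate, Set.Icc.coe_mul, unitInterval.coe_symm_eq]
  change (0 : ℝ) < _
  have : (0 : ℝ) < 1 - t := by linarith
  positivity

lemma restartRate_le (c t : unitInterval) : (restartRate c t : ℝ) ≤ c :=
  unitInterval.mul_le_left

open Classical in
/-- A path of measures from `μ` to `ν`, ergodic in the interior. -/
noncomputable def restartPath (μ ν : ProbabilityMeasure (ℤ → D)) (c t : unitInterval) :
    ProbabilityMeasure (ℤ → D) :=
  if t = 0 then μ else if t = 1 then ν else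
    restartLaw μ ν (restartRate c t) (t * restartRate c t)

variable {μ ν : ProbabilityMeasure (ℤ → D)}

lemma restartPath_zero (c : unitInterval) : restartPath μ ν c 0 = μ := by simp [restartPath]

lemma restartPath_one (c : unitInterval) : restartPath μ ν c 1 = ν := by simp [restartPath]

lemma restartPath_of_ne (c : unitInterval) {t : unitInterval} (h0 : t ≠ 0) (h1 : t ≠ 1) :
    restartPath μ ν c t = restartLaw μ ν (restartRate c t) (t * restartRate c t) := by
  simp [restartPath, h0, h1]

lemma abs_integral_restartPath_sub_mixedIntegral_le {f : (ℤ → D) → ℝ} (hf : Continuous f) {C : ℝ}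
    (hC0 : 0 ≤ C) (hC : ∀ y, |f y| ≤ C) {ε : ℝ} (hε : 0 < ε) :
    ∃ L : ℝ, 0 ≤ L ∧ ∀ μ ν : ProbabilityMeasure (ℤ → D),
      MeasurePreserving fullShift (μ : Measure (ℤ → D)) μ →
      MeasurePreserving fullShift (ν : Measure (ℤ → D)) ν → ∀ c t : unitInterval, 0 < c →
        |∫ y, f y ∂(restartPath μ ν c t : Measure (ℤ → D)) - mixedIntegral μ ν t f| ≤
          ε + L * restartRate c t := by
  obtain ⟨L, hL, h⟩ := abs_integral_restart_sub_mixedIntegral_le hf hC0 hC hε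
  refine ⟨L, hL, fun μ ν hμ hν c t hc => ?_⟩
  have h0 := mul_nonneg hL (restartRate c t).2.1
  by_cases ht0 : t = 0
  · subst ht0
    rw [restartPath_zero, mixedIntegral]
    simp only [Set.Icc.coe_zero, sub_zero, one_mul, zero_mul, add_zero, sub_self, abs_zero]
    linarith
  by_cases ht1 : t = 1
  · subst ht1
    rw [restartPath_one, mixedIntegral]
    simp only [Set.Icc.coe_one, sub_self, one_mul, zero_mul, zero_add, abs_zero]
    linarith
  · rw [restartPath_of_ne c ht0 ht1, integral_restartLaw _ _ _ _ hf.measurable]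
    exact h μ ν hμ hν _ t (restartRate_pos hc ht0 ht1)

/-- A window of length one has no room for a restart in its interior, so the one-letter marginal is
that of the mixture without error. -/
lemma integral_restartPath_eval (hμ : MeasurePreserving fullShift (μ : Measure (ℤ → D)) μ)
    (hν : MeasurePreserving fullShift (ν : Measure (ℤ → D)) ν) {c : unitInterval} (hc : 0 < c)
    (t : unitInterval) (g : D → ℝ) :
    ∫ y, g (y 0) ∂(restartPath μ ν c t : Measure (ℤ → D)) =
      mixedIntegral (μ : Measure (ℤ → D)) ν t fun y => g (y 0) := by
  by_cases ht0 : t = 0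
  · subst ht0
    simp [restartPath_zero, mixedIntegral]
  by_cases ht1 : t = 1
  · subst ht1
    simp [restartPath_one, mixedIntegral]
  have hm : Measurable fun y : ℤ → D => g (y 0) := Measurable.of_discrete.comp (measurable_pi_apply 0)
  obtain ⟨C, hC⟩ : ∃ C, ∀ a, |g a| ≤ C := by
    obtain ⟨C, hC⟩ := (Set.finite_range fun a => |g a|).bddAbove
    exact ⟨C, fun a => hC ⟨a, rfl⟩⟩
  rw [restartPath_of_ne c ht0 ht1, integral_restartLaw _ _ _ _ hm]
  have h := setIntegral_restart_noRestart hμ hν (restartRate_pos hc ht0 ht1) t hm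
    (fun y => hC (y 0)) (le_refl (0 : ℤ)) fun x y hxy => by rw [hxy 0 le_rfl le_rfl]
  have hu : noRestart D (restartRate c t) 0 0 = Set.univ := by
    ext ω
    simp only [noRestart, Set.mem_ofPred_eq, Set.mem_univ, iff_true]
    intro i hi hi'
    omega
  simpa [hu] using h

lemma tendsto_restartLaw {a b : unitInterval → unitInterval} {t₀ : unitInterval}
    (ha : ContinuousAt a t₀) (hb : ContinuousAt b t₀) (hpos : 0 < a t₀) :
    Tendsto (fun t => restartLaw μ ν (a t) (b t)) (nhds t₀) (nhds (restartLaw μ ν (a t₀) (b t₀))) := by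
  rw [ProbabilityMeasure.tendsto_iff_forall_integral_tendsto]
  intro f
  simp_rw [integral_restartLaw μ ν _ _ f.continuous.measurable]
  refine tendsto_integral_filter_of_dominated_convergence (fun _ => ‖f‖) (Eventually.of_forall
    fun t => (f.continuous.measurable.comp (measurable_restart _ _)).aestronglyMeasurable)
    (Eventually.of_forall fun t => Eventually.of_forall fun ω => f.norm_coe_le_norm _)
    (integrable_const _) ?_
  filter_upwards [ae_clock_ne (μ : Measure (ℤ → D)) ν (a t₀), ae_clock_ne (μ : Measure (ℤ → D)) ν
    (b t₀), ae_exists_lastRestart (μ : Measure (ℤ → D)) ν hpos] with ω h1 h2 h3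
  exact (f.continuous.tendsto _).comp (tendsto_restart ha hb h1 h2 h3)

lemma continuous_restartRate (c : unitInterval) : Continuous (restartRate c) := by
  unfold restartRate; fun_prop

lemma continuous_restartPath (hμ : MeasurePreserving fullShift (μ : Measure (ℤ → D)) μ)
    (hν : MeasurePreserving fullShift (ν : Measure (ℤ → D)) ν) {c : unitInterval} (hc : 0 < c) :
    Continuous (restartPath μ ν c) := by
  rw [continuous_iff_continuousAt]
  intro t₀
  by_cases ht : t₀ ≠ 0 ∧ t₀ ≠ 1
  · have h := tendsto_restartLaw (μ := μ) (ν := ν) (t₀ := t₀) (a := restartRate c)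
      (b := fun t => t * restartRate c t) (continuous_restartRate c).continuousAt
      (continuous_id.mul (continuous_restartRate c)).continuousAt (restartRate_pos hc ht.1 ht.2)
    rw [ContinuousAt, restartPath_of_ne c ht.1 ht.2]
    refine h.congr' ?_
    filter_upwards [eventually_ne_nhds ht.1, eventually_ne_nhds ht.2] with t h0 h1
    rw [restartPath_of_ne c h0 h1]
  -- At the end points pathwise convergence is unavailable, since restarts disappear; the uniform
  -- comparison with the mixture takes over because the rate tends to zero.
  · have hr0 : restartRate c t₀ = 0 := by
      rw [restartRate]
      by_cases h0 : t₀ = 0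
      · simp [h0]
      · have h1 : t₀ = 1 := by tauto
        simp [h1]
    rw [ContinuousAt, ProbabilityMeasure.tendsto_iff_forall_integral_tendsto]
    intro f
    rw [Metric.tendsto_nhds]
    intro ε hε
    obtain ⟨L, hL, h⟩ := abs_integral_restartPath_sub_mixedIntegral_le f.continuous (norm_nonneg f)
      (fun y => f.norm_coe_le_norm y) (show 0 < ε / 4 by positivity)
    have h1 : Tendsto (fun t : unitInterval => L * (restartRate c t : ℝ)) (nhds t₀) (nhds 0) := by
      have : Continuous fun t : unitInterval => L * (restartRate c t : ℝ) :=
        continuous_const.mul (continuous_subtype_val.comp (continuous_restartRate c))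
      simpa [hr0] using this.tendsto t₀
    have h2 : Tendsto (fun t : unitInterval => mixedIntegral (μ : Measure (ℤ → D)) ν t f) (nhds t₀)
        (nhds (mixedIntegral (μ : Measure (ℤ → D)) ν t₀ f)) := by
      have : Continuous fun t : unitInterval => mixedIntegral (μ : Measure (ℤ → D)) ν t f := by
        unfold mixedIntegral
        fun_prop
      exact this.tendsto t₀
    filter_upwards [h1.eventually (gt_mem_nhds (show 0 < ε / 4 by positivity)),
      Metric.tendsto_nhds.1 h2 (ε / 4) (by positivity)] with t ht1 ht2
    have h3 := h μ ν hμ hν c t hc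
    have h4 := h μ ν hμ hν c t₀ hc
    simp only [hr0, Set.Icc.coe_zero, mul_zero, add_zero] at h4
    rw [Real.dist_eq] at ht2 ⊢
    rw [abs_lt] at ht2 ⊢
    rw [abs_le] at h3 h4
    constructor <;> linarith

/-- If the restart rates tend to zero and `ν` tends to `μ`, then the whole path from `μ` to `ν`
tends to `μ`. -/
lemma tendsto_restartPath (hμ : MeasurePreserving fullShift (μ : Measure (ℤ → D)) μ) :
    Tendsto (fun p : (unitInterval × ProbabilityMeasure (ℤ → D)) × unitInterval =>
        restartPath μ p.1.2 p.1.1 p.2)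
      ((nhdsWithin 0 (Set.Ioi 0) ×ˢ nhdsWithin μ
        {ν | MeasurePreserving fullShift (ν : Measure (ℤ → D)) ν}) ×ˢ ⊤) (nhds μ) := by
  rw [ProbabilityMeasure.tendsto_iff_forall_integral_tendsto]
  intro f
  rw [Metric.tendsto_nhds]
  intro ε hε
  obtain ⟨L, hL, h⟩ := abs_integral_restartPath_sub_mixedIntegral_le f.continuous (norm_nonneg f)
    (fun y => f.norm_coe_le_norm y) (show 0 < ε / 4 by positivity)
  have h1 : ∀ᶠ c : unitInterval in nhdsWithin (0 : unitInterval) (Set.Ioi 0), L * (c : ℝ) < ε / 4 ∧ 0 < c := by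
    refine (Eventually.filter_mono nhdsWithin_le_nhds ?_).and eventually_mem_nhdsWithin
    have : Continuous fun c : unitInterval => L * (c : ℝ) := by fun_prop
    exact (this.tendsto 0).eventually (gt_mem_nhds (by simpa using hε))
  have h2 : ∀ᶠ ν : ProbabilityMeasure (ℤ → D) in nhdsWithin μ
      {ν | MeasurePreserving fullShift (ν : Measure (ℤ → D)) ν},
      |∫ y, f y ∂(ν : Measure (ℤ → D)) - ∫ y, f y ∂(μ : Measure (ℤ → D))| < ε / 4 ∧
        MeasurePreserving fullShift (ν : Measure (ℤ → D)) ν := by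
    refine (Eventually.filter_mono nhdsWithin_le_nhds ?_).and eventually_mem_nhdsWithin
    have h3 := ProbabilityMeasure.tendsto_iff_forall_integral_tendsto.1 (tendsto_id (x := nhds μ)) f
    have h4 := Metric.tendsto_nhds.1 h3 (ε / 4) (by positivity)
    exact h4
  filter_upwards [(h1.prod_mk h2).prod_inl ⊤] with p ⟨⟨hc, hc0⟩, hν, hνi⟩
  obtain ⟨⟨c, ν⟩, t⟩ := p
  simp only at hc hc0 hν hνi ⊢
  have h3 := h μ ν hμ hνi c t hc0
  have h4 := mul_le_mul_of_nonneg_left (restartRate_le c t) hL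
  have h5 : |mixedIntegral (μ : Measure (ℤ → D)) ν t f - ∫ y, f y ∂(μ : Measure (ℤ → D))| ≤
      ε / 4 := by
    have e : mixedIntegral (μ : Measure (ℤ → D)) ν t f - ∫ y, f y ∂(μ : Measure (ℤ → D)) =
        t * (∫ y, f y ∂(ν : Measure (ℤ → D)) - ∫ y, f y ∂(μ : Measure (ℤ → D))) := by
      rw [mixedIntegral]; ring
    rw [e, abs_mul, abs_of_nonneg t.2.1]
    exact (mul_le_of_le_one_left (abs_nonneg _) t.2.2).trans hν.le
  rw [Real.dist_eq, abs_lt]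
  rw [abs_le] at h3 h5
  constructor <;> linarith

end RestartPath

/-! ### Path connectedness for drifting ergodic measures on the full shift -/

section DriftErgodic

variable {D : Type*} [TopologicalSpace D] [DiscreteTopology D] [Finite D] [MeasurableSpace D]
  [BorelSpace D]

/-- Ergodic measures on the full shift for which the height has a drift. -/
def driftErgodic (g : D → ℤ) : Set (ProbabilityMeasure (ℤ → D)) :=
  {μ | Ergodic fullShift (μ : Measure (ℤ → D)) ∧ (μ : Measure (ℤ → D)) (driftSet g) = 1}

/-- This trades an almost sure asymptotic condition for the sign of an integral that is affine in
the measure. -/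
lemma mem_driftErgodic_iff {g : D → ℤ} (hg : ∀ a, |g a| ≤ 1) {μ : ProbabilityMeasure (ℤ → D)} :
    μ ∈ driftErgodic g ↔ Ergodic fullShift (μ : Measure (ℤ → D)) ∧
      0 < ∫ y, (g (y 0) : ℝ) ∂(μ : Measure (ℤ → D)) := by
  refine and_congr_right fun hμ => ?_
  rw [← mem_ae_iff_prob_eq_one (measurableSet_driftSet g)]
  exact ⟨integral_pos_of_ae_mem_driftSet hμ.toMeasurePreserving hg,
    ae_mem_driftSet_of_integral_pos hμ hg⟩

lemma restartPath_mem_driftErgodic {g : D → ℤ} (hg : ∀ a, |g a| ≤ 1)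
    {μ ν : ProbabilityMeasure (ℤ → D)} (hμ : μ ∈ driftErgodic g) (hν : ν ∈ driftErgodic g)
    {c : unitInterval} (hc : 0 < c) (t : unitInterval) : restartPath μ ν c t ∈ driftErgodic g := by
  by_cases ht0 : t = 0
  · rwa [ht0, restartPath_zero]
  by_cases ht1 : t = 1
  · rwa [ht1, restartPath_one]
  rw [mem_driftErgodic_iff hg] at hμ hν ⊢
  refine ⟨?_, ?_⟩
  · rw [restartPath_of_ne c ht0 ht1]
    exact ergodic_restartLaw μ ν _ _
  · rw [integral_restartPath_eval hμ.1.toMeasurePreserving hν.1.toMeasurePreserving hc t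
      fun a => (g a : ℝ), mixedIntegral]
    have h1 : (0 : ℝ) < t := unitInterval.pos_iff_ne_zero.2 ht0
    have h2 : (t : ℝ) < 1 := unitInterval.lt_one_iff_ne_one.2 ht1
    exact add_pos (mul_pos (by linarith) hμ.2) (mul_pos h1 hν.2)

/-- The restart path inside the space of ergodic measures with drift. -/
noncomputable def driftPath {g : D → ℤ} (hg : ∀ a, |g a| ≤ 1) (μ ν : driftErgodic g)
    {c : unitInterval} (hc : 0 < c) : Path μ ν where
  toFun t := ⟨restartPath μ.1 ν.1 c t, restartPath_mem_driftErgodic hg μ.2 ν.2 hc t⟩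
  continuous_toFun := (continuous_restartPath μ.2.1.toMeasurePreserving
    ν.2.1.toMeasurePreserving hc).subtype_mk _
  source' := Subtype.ext (restartPath_zero c)
  target' := Subtype.ext (restartPath_one c)

lemma nonempty_driftErgodic {g : D → ℤ} (hg : ∀ a, |g a| ≤ 1) {a : D} (ha : 0 < g a) :
    (driftErgodic g).Nonempty := by
  let δ : ProbabilityMeasure (ℤ → D) := ⟨Measure.dirac fun _ => a, inferInstance⟩
  refine ⟨δ, (mem_driftErgodic_iff hg).2 ⟨⟨⟨measurable_fullShift, ?_⟩, ⟨fun {s} hs _ => ?_⟩⟩, ?_⟩⟩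
  · exact Measure.map_dirac' measurable_fullShift _
  · rw [eventuallyConst_set]
    by_cases h : (fun _ => a) ∈ s
    · left
      exact (ae_dirac_iff hs).2 h
    · right
      exact (ae_dirac_iff hs.compl).2 h
  · change 0 < ∫ y, (g (y 0) : ℝ) ∂Measure.dirac fun _ => a
    rw [integral_dirac]
    exact_mod_cast ha

lemma pathConnectedSpace_driftErgodic {g : D → ℤ} (hg : ∀ a, |g a| ≤ 1) {a : D} (ha : 0 < g a) :
    PathConnectedSpace (driftErgodic g) where
  nonempty := (nonempty_driftErgodic hg ha).to_subtype
  joined μ ν := ⟨driftPath hg μ ν (c := 1) one_pos⟩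

lemma locallyPathConnectedSpace_driftErgodic {g : D → ℤ} (hg : ∀ a, |g a| ≤ 1) :
    LocallyPathConnectedSpace (driftErgodic g) := by
  rw [locallyPathConnectedSpace_iff_pathComponentIn_mem_nhds]
  intro μ u hu hμu
  obtain ⟨U, hU, rfl⟩ := isOpen_induced_iff.1 hu
  have h := (tendsto_restartPath μ.2.1.toMeasurePreserving).eventually (hU.mem_nhds hμu)
  -- The filter `⊤` on the time parameter becomes a universal quantifier: the entire path lies in
  -- `U`.
  rw [← principal_univ, eventually_prod_principal_iff] at h
  have h0 : (nhdsWithin (0 : unitInterval) (Set.Ioi 0)).NeBot := by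
    rw [← mem_closure_iff_nhdsWithin_neBot, closure_Ioi' ⟨1, one_pos⟩]
    exact Set.self_mem_Ici
  -- One small positive `c` is fixed before the neighbourhood of `μ` is chosen.
  obtain ⟨c, hc, hc0⟩ := (h.curry.and eventually_mem_nhdsWithin).exists
  rw [eventually_nhdsWithin_iff] at hc
  have hc' : ∀ᶠ ν : driftErgodic g in nhds μ, ∀ t, restartPath μ.1 ν.1 c t ∈ U := by
    filter_upwards [(continuous_subtype_val.tendsto μ).eventually hc] with ν hν t
    exact hν ν.2.1.toMeasurePreserving t trivial
  filter_upwards [hc'] with ν hν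
  exact ⟨driftPath hg μ ν hc0, hν⟩

end DriftErgodic

/-- The continuous mapping theorem. -/
lemma continuousAt_map_of_ae_continuousAt {X Y : Type*} [TopologicalSpace X] [TopologicalSpace Y]
    [MeasurableSpace X] [MeasurableSpace Y] [OpensMeasurableSpace X] [OpensMeasurableSpace Y]
    [HasOuterApproxClosed X] [FirstCountableTopology (ProbabilityMeasure X)] {φ : X → Y}
    (hφ : Measurable φ) {μ : ProbabilityMeasure X} (h : ∀ᵐ x ∂(μ : Measure X), ContinuousAt φ x) :
    ContinuousAt (fun ν : ProbabilityMeasure X => ν.map hφ.aemeasurable) μ := by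
  refine tendsto_of_forall_isOpen_le_liminf' fun G hG => ?_
  have hmap : ∀ ν : ProbabilityMeasure X,
      ((ν.map hφ.aemeasurable : ProbabilityMeasure Y) : Measure Y) G = (ν : Measure X) (φ ⁻¹' G) :=
    fun ν => Measure.map_apply hφ hG.measurableSet
  simp_rw [hmap]
  -- A point of `φ ⁻¹' G` outside the interior is a discontinuity of `φ`, hence lies in a null set.
  calc (μ : Measure X) (φ ⁻¹' G) ≤ (μ : Measure X) (interior (φ ⁻¹' G)) := by
        refine measure_mono_ae ?_
        filter_upwards [h] with x hx hxG
        exact mem_interior_iff_mem_nhds.2 (hx.preimage_mem_nhds (hG.mem_nhds hxG))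
    _ ≤ liminf (fun ν : ProbabilityMeasure X => (ν : Measure X) (interior (φ ⁻¹' G))) (nhds μ) :=
        ProbabilityMeasure.le_liminf_measure_open_of_tendsto tendsto_id isOpen_interior
    _ ≤ _ := liminf_le_liminf (Eventually.of_forall fun ν => measure_mono interior_subset)

/-! ### Transfer to the Dyck-Motzkin shift -/

section Retract

lemma measurable_shift : Measurable (shift M N) :=
  (measurable_fullShift.comp measurable_subtype_coe).subtype_mk

lemma signedWeight_pos_exists (N : ℕ) (b : Bool) (hM : 0 < M) :
    ∃ a : Symbol M N, 0 < signedWeight b a := by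
  cases b
  · exact ⟨.right ⟨0, hM⟩, by simp [signedWeight, weight]⟩
  · exact ⟨.left ⟨0, hM⟩, by simp [signedWeight, weight]⟩

lemma map_val_mem_driftErgodic {b : Bool} {μ : ProbabilityMeasure (shiftSpace M N)}
    (hμ : μ ∈ ergodicOn (driftingPart M N b)) :
    μ.map (measurable_subtype_coe (p := (· ∈ shiftSpace M N))).aemeasurable ∈
      driftErgodic (signedWeight b) := by
  have hmp : MeasurePreserving Subtype.val (μ : Measure (shiftSpace M N))
      (μ.map (measurable_subtype_coe (p := (· ∈ shiftSpace M N))).aemeasurable :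
        ProbabilityMeasure (ℤ → Symbol M N)) := ⟨measurable_subtype_coe, rfl⟩
  refine ⟨hmp.ergodic_of_ergodic_semiconj hμ.1 measurable_fullShift fun y => rfl, ?_⟩
  rw [← hmp.measure_preimage (measurableSet_driftSet _).nullMeasurableSet, ← hμ.2]
  congr 1; ext y
  exact mem_driftingPart_iff.symm

variable [Nonempty (Fin M)]

lemma map_repair_mem_ergodicOn {b : Bool} {μ : ProbabilityMeasure (ℤ → Symbol M N)}
    (hμ : μ ∈ driftErgodic (signedWeight b)) :
    μ.map (measurable_repair b).aemeasurable ∈ ergodicOn (driftingPart M N b) := by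
  have hmp : MeasurePreserving (repair b) (μ : Measure (ℤ → Symbol M N))
      (μ.map (measurable_repair b).aemeasurable : ProbabilityMeasure (shiftSpace M N)) :=
    ⟨measurable_repair b, rfl⟩
  have hA : MeasurableSet (driftingPart M N b) := by
    have e : driftingPart M N b = Subtype.val ⁻¹' driftSet (signedWeight b) := by
      ext x; exact mem_driftingPart_iff
    rw [e]
    exact measurable_subtype_coe (measurableSet_driftSet _)
  refine ⟨hmp.ergodic_of_ergodic_semiconj hμ.1 measurable_shift fun y => repair_fullShift b y, ?_⟩
  rw [← hmp.measure_preimage hA.nullMeasurableSet, ← hμ.2]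
  congr 1; ext y
  exact repair_mem_driftingPart_iff

/-- Pushing forward by the inclusion and then by `repair` is the identity, so the pushforward by
`repair` is a continuous surjection and a quotient map, and both properties descend along it. -/
lemma connected_ergodicOn_driftingPart (N : ℕ) (hM : 0 < M) (b : Bool) :
    PathConnectedSpace (ergodicOn (driftingPart M N b)) ∧
      LocallyPathConnectedSpace (ergodicOn (driftingPart M N b)) := by
  let r : driftErgodic (signedWeight (M := M) (N := N) b) → ergodicOn (driftingPart M N b) :=
    fun μ => ⟨_, map_repair_mem_ergodicOn μ.2⟩
  let i : ergodicOn (driftingPart M N b) → driftErgodic (signedWeight (M := M) (N := N) b) :=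
    fun μ => ⟨_, map_val_mem_driftErgodic μ.2⟩
  have hr : Continuous r := by
    refine Continuous.subtype_mk (continuous_iff_continuousAt.2 fun μ => ?_) _
    -- Continuity of `repair` is known only at sequences with drift, but these have full measure
    -- here.
    refine ContinuousAt.comp (f := Subtype.val) (continuousAt_map_of_ae_continuousAt
      (measurable_repair b) ?_) continuous_subtype_val.continuousAt
    have h := (mem_ae_iff_prob_eq_one (measurableSet_driftSet (signedWeight b))).2 μ.2.2
    filter_upwards [h] with y hy
    exact continuousAt_repair hy
  have hi : Continuous i :=
    ((ProbabilityMeasure.continuous_map continuous_subtype_val).comp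
      continuous_subtype_val).subtype_mk _
  have hri : Function.LeftInverse r i := by
    intro μ
    apply Subtype.ext
    apply Subtype.ext
    change Measure.map (repair b) (Measure.map Subtype.val (μ.1 : Measure (shiftSpace M N))) = _
    rw [Measure.map_map (measurable_repair b) measurable_subtype_coe]
    have e : repair b ∘ Subtype.val = (id : shiftSpace M N → shiftSpace M N) := by
      funext x; exact repair_val b x
    rw [e, Measure.map_id]
    rfl
  obtain ⟨a, ha⟩ := signedWeight_pos_exists N b hM
  have h1 := pathConnectedSpace_driftErgodic (abs_signedWeight_le (M := M) (N := N) b) ha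
  have h2 := locallyPathConnectedSpace_driftErgodic (abs_signedWeight_le (M := M) (N := N) b)
  exact ⟨hri.surjective.pathConnectedSpace hr,
    (Topology.IsQuotientMap.of_inverse hi hr hri).locallyPathConnectedSpace⟩

end Retract

end DyckMotzkin

theorem mainTheorem5 (M N : ℕ) (hM : 2 ≤ M) :
    (PathConnectedSpace (DyckMotzkin.ergodicOn (DyckMotzkin.setAlpha M N)) ∧
      LocallyPathConnectedSpace (DyckMotzkin.ergodicOn (DyckMotzkin.setAlpha M N))) ∧
    (PathConnectedSpace (DyckMotzkin.ergodicOn (DyckMotzkin.setBeta M N)) ∧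
      LocallyPathConnectedSpace (DyckMotzkin.ergodicOn (DyckMotzkin.setBeta M N))) := by
  have hne : Nonempty (Fin M) := ⟨⟨0, by omega⟩⟩
  exact ⟨DyckMotzkin.connected_ergodicOn_driftingPart N (by omega) true,
    DyckMotzkin.connected_ergodicOn_driftingPart N (by omega) false⟩
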